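/- Let $d\ge 1$ and let $\Omega\subset\mathbb R^d$ be a nonempty bounded open polyhedron (the interior of a finite union of simplices). For $\delta>0$ put $\Omega_\delta^c=\{y\in\mathbb R^d\setminus\Omega:\operatorname{dist}(y,\partial\Omega)<\delta\}$, $\widehat\Omega_\delta=\Omega\cup\Omega_\delta^c$, and let $B_\delta(x)$ be the Euclidean ball. For an open set $U$, $C^4_b(U)$ is the set of $C^4$ functions on $U$ whose derivatives of order $\le 4$ are bounded on $U$. Let $u_0\in C^4_b(\Omega)\cap C(\overline\Omega)$ solve $-\Delta u_0=f_0$ in $\Omega$, $u_0=g_0$ on $\partial\Omega$. Fix $\delta_0>0$; below, $\delta$ ranges over $(0,\delta_0]$. *Kernels.* $\gamma_\delta(x,y)=\widetilde\gamma_\delta(|y-x|)$ with $\widetilde\gamma_\delta\ge 0$ measurable, $\widetilde\gamma_\delta(s)=0$ for $s>\delta$, $\widetilde\gamma_\delta(s)>0$ for $0<s<\delta$, $\widetilde\gamma_\delta\in L^1(0,\delta)$ and $w_d\int_0^\delta s^{d+1}\widetilde\gamma_\delta(s)\,ds=d$, where $w_d$ is the surface area of the unit sphere of $\mathbb R^d$.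 Moreover, with a constant independent of $\delta$, $$G(\gamma_\delta):=\sup_{x\in\widehat\Omega_\delta}\int_{B_\delta(x)\cap\widehat\Omega_\delta}\gamma_\delta(x,y)\,dy\lesssim\delta^{-2}.$$ *Data.* For each $\delta$ let $D_\delta$ be a set with $\Omega_\delta^c\subset D_\delta\subset\mathbb R^d\setminus\Omega$ (the polyhedral region, for instance $\Omega_\delta^c$ with its rounded corners replaced by sharp ones, on which the volume constraint is discretized). Let $U$ be an open set containing $\Omega$ and all $D_\delta$, and let $\widetilde u_0\in C^4_b(U)$ satisfy $\widetilde u_0=u_0$ on $\Omega$. Let $\mu\in\{0,1\}$, let $f_\delta\in C(\Omega)$, $g_\delta\in C(D_\delta)$, and assume, with constants independent of $\delta$, that $$\sup_\Omega|f_\delta-f_0|=O(\delta^2),\qquad \sup_{D_\delta}|g_\delta-\widetilde u_0|=O(\delta^{2+\mu}).$$ *CDG approximation.* Let $h>0$, and let $\mathcal T$ and $\mathcal T^c$ be finite conforming simplicial triangulations of $\overline\Omega$ and of $D_\delta$ respectively, with all simplices of diameter at most $h$ (they need not match across $\partial\Omega$). Let $V_\delta^{0,h}$ be the space of functions that are on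 $\Omega$ the restriction of a continuous piecewise linear function on $\mathcal T$ and vanish outside $\Omega$. Let $g_\delta^h$ be the restriction to $\Omega_\delta^c$, extended by zero, of a continuous piecewise linear function on $\mathcal T^c$ whose nodal values differ from those of $g_\delta$ by at most $\kappa h^2$, where $\kappa$ is a fixed constant ($\kappa=0$: the nodal interpolant). The linear CDG approximation is $u_\delta^h=u_\delta^{0,h}+g_\delta^h$, where $u_\delta^{0,h}\in V_\delta^{0,h}$ satisfies, for all $w\in V_\delta^{0,h}$, $$-2\int_\Omega w(x)\int_{B_\delta(x)\cap\Omega}\bigl(u_\delta^{0,h}(y)-u_\delta^{0,h}(x)\bigr)\gamma_\delta(x,y)\,dy\,dx=\int_\Omega f_\delta w\,dx+2\int_\Omega w(x)\int_{B_\delta(x)\cap\Omega_\delta^c}\bigl(g_\delta^h(y)-u_\delta^{0,h}(x)\bigr)\gamma_\delta(x,y)\,dy\,dx .$$ Put $\|v\|_\delta=\bigl(\int_{\widehat\Omega_\delta}\int_{\widehat\Omega_\delta}(v(y)-v(x))^2\gamma_\delta(x,y)\,dy\,dx\bigr)^{1/2}$. **Theorem.** There is a constant $C>0$, independent of $\delta\in(0,\delta_0]$,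 of $h>0$, of the triangulations $\mathcal T,\mathcal T^c$ and of the choice of $g_\delta^h$, such that every linear CDG approximation $u_\delta^h$ satisfies $$\|\widetilde u_0-u_\delta^h\|_\delta\le C\bigl(\delta^{(3+\mu)/2}+\delta^{-1}h^2\bigr),\qquad \|u_0-u_\delta^h\|_{L^2(\Omega)}\le C\bigl(\delta^{(3+\mu)/2}+\delta^{-1}h^2\bigr).$$ -/

import Mathlib

open MeasureTheory Set
open scoped ENNReal

noncomputable section

namespace NonlocalCDG

/-- Euclidean space `ℝ^d`. -/
abbrev E (d : ℕ) : Type := EuclideanSpace ℝ (Fin d)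

/-- A bounded open polyhedron: a nonempty set that is the interior of a finite union of simplices
(presented as the underlying space of a finite simplicial complex). -/
def IsOpenPolyhedron {d : ℕ} (Ω : Set (E d)) : Prop :=
  Ω.Nonempty ∧ ∃ K : Geometry.SimplicialComplex ℝ (E d), K.faces.Finite ∧ Ω = interior K.space

/-- The interaction domain `Ω_δ^c = {y ∉ Ω : dist (y, ∂Ω) < δ}`. -/
def interactionDomain {d : ℕ} (Ω : Set (E d)) (δ : ℝ) : Set (E d) :=
  {y | y ∉ Ω ∧ Metric.infDist y (frontier Ω) < δ}

/-- The enlarged domain `Ω ∪ Ω_δ^c`. -/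
def enlargedDomain {d : ℕ} (Ω : Set (E d)) (δ : ℝ) : Set (E d) :=
  Ω ∪ interactionDomain Ω δ

/-- The surface area `w_d` of the unit sphere of `ℝ^d`. -/
def sphereArea (d : ℕ) : ℝ :=
  (volume : Measure (E d)).toSphere.real univ

/-- `γ : ℝ → ℝ` is an admissible radial kernel profile with horizon `δ`; the kernel is
`(x, y) ↦ γ ‖y - x‖`.  Only the values of `γ` on `[0, ∞)` matter. -/
structure IsKernelProfile (d : ℕ) (δ : ℝ) (γ : ℝ → ℝ) : Prop where
  measurable : Measurable γ
  nonneg : ∀ s, 0 ≤ s → 0 ≤ γ s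
  eq_zero : ∀ s, δ < s → γ s = 0
  pos : ∀ s, 0 < s → s < δ → 0 < γ s
  integrable : IntegrableOn γ (Ioo 0 δ)
  moment : sphereArea d * ∫ s in Ioo 0 δ, s ^ (d + 1) * γ s = d

/-- `G(γ_δ) = sup_{x ∈ Ω ∪ Ω_δ^c} ∫_{B_δ(x) ∩ (Ω ∪ Ω_δ^c)} γ_δ(x, y) dy`, as an extended
nonnegative number. -/
def kernelMass {d : ℕ} (Ω : Set (E d)) (δ : ℝ) (γ : ℝ → ℝ) : ℝ≥0∞ :=
  ⨆ x ∈ enlargedDomain Ω δ,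
    ∫⁻ y in Metric.ball x δ ∩ enlargedDomain Ω δ, ENNReal.ofReal (γ ‖y - x‖)

/-- The nonlocal energy norm
`‖u‖_δ = (∫_{Ω ∪ Ω_δ^c} ∫_{Ω ∪ Ω_δ^c} (u y - u x)² γ_δ(x, y) dy dx)^{1/2}`, with values in
`[0, ∞]`. -/
def energyNorm {d : ℕ} (Ω : Set (E d)) (δ : ℝ) (γ : ℝ → ℝ) (u : E d → ℝ) : ℝ≥0∞ :=
  (∫⁻ x in enlargedDomain Ω δ, ∫⁻ y in enlargedDomain Ω δ,
    ENNReal.ofReal ((u y - u x) ^ 2 * γ ‖y - x‖)) ^ (1 / 2 : ℝ)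

/-- `u ∈ C_b^n(D)` for an open set `D`: all derivatives of order at most `n` exist, are continuous
and are bounded on `D`. -/
def IsCb {d : ℕ} (n : ℕ) (D : Set (E d)) (u : E d → ℝ) : Prop :=
  ContDiffOn ℝ n u D ∧ ∀ k ≤ n, ∃ M : ℝ, ∀ x ∈ D, ‖iteratedFDeriv ℝ k u x‖ ≤ M

/-- `u` is a classical solution of `-Δ u = f` on `Ω`, `u = g` on `∂Ω`. -/
structure IsLocalSolution {d : ℕ} (Ω : Set (E d)) (f g u : E d → ℝ) : Prop where
  contDiffOn : ContDiffOn ℝ 2 u Ω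
  continuousOn : ContinuousOn u (closure Ω)
  pde : ∀ x ∈ Ω, -(Laplacian.laplacian u x) = f x
  boundary : ∀ x ∈ frontier Ω, u x = g x

/-- `K` is a (conforming, finite) simplicial triangulation of the set `D` with mesh size at
most `h`. -/
structure IsTriangulation {d : ℕ} (K : Geometry.SimplicialComplex ℝ (E d)) (D : Set (E d))
    (h : ℝ) : Prop where
  finite : K.faces.Finite
  space_eq : K.space = D
  diam_le : ∀ s ∈ K.faces, Metric.diam (convexHull ℝ (s : Set (E d))) ≤ h

/-- `v` is, on the underlying space of `K`, a continuous piecewise linear finite element function: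
it coincides with an affine function on every simplex (and hence is continuous there). -/
def IsPiecewiseLinear {d : ℕ} (K : Geometry.SimplicialComplex ℝ (E d)) (v : E d → ℝ) : Prop :=
  ∀ s ∈ K.faces, ∃ A : E d →ᵃ[ℝ] ℝ, EqOn v A (convexHull ℝ (s : Set (E d)))

/-- The space `V_δ^{0,h}`: continuous piecewise linear on the triangulation `K` of the closure
of `Ω`, and zero outside `Ω`. -/
def interiorSpace {d : ℕ} (Ω : Set (E d)) (K : Geometry.SimplicialComplex ℝ (E d)) :
    Set (E d → ℝ) :=
  {w | ∃ v, IsPiecewiseLinear K v ∧ w = Ω.indicator v}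

/-- `g` is a discrete volume constraint approximating the data `gδ`: it belongs to `V_δ^{c,h}`
(continuous piecewise linear on the exterior triangulation `K`, and zero outside the interaction
domain), and its nodal values agree with those of `gδ` up to `ε` (for `ε = 0` it is the nodal
interpolant). -/
def IsDataApprox {d : ℕ} (Ω : Set (E d)) (δ : ℝ) (K : Geometry.SimplicialComplex ℝ (E d))
    (gδ : E d → ℝ) (ε : ℝ) (g : E d → ℝ) : Prop :=
  ∃ v, IsPiecewiseLinear K v ∧ (∀ p ∈ K.vertices, |v p - gδ p| ≤ ε) ∧
    g = (interactionDomain Ω δ).indicator v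

/-- `u` is the linear CDG approximation with exact ball neighborhoods, for the triangulation `K` of
the closure of `Ω`, the right-hand side `f` and the discrete volume constraint `g`: `u = u₀ + g`
with `u₀ ∈ V_δ^{0,h}` solving the Galerkin equations for all test functions in `V_δ^{0,h}`. -/
def IsCDGSolution {d : ℕ} (Ω : Set (E d)) (δ : ℝ) (γ : ℝ → ℝ)
    (K : Geometry.SimplicialComplex ℝ (E d)) (f g u : E d → ℝ) : Prop :=
  ∃ u₀ ∈ interiorSpace Ω K,
    (∀ w ∈ interiorSpace Ω K,
      -2 * (∫ x in Ω, w x * ∫ y in Metric.ball x δ ∩ Ω, (u₀ y - u₀ x) * γ ‖y - x‖) =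
        (∫ x in Ω, f x * w x) +
          2 * ∫ x in Ω, w x *
            ∫ y in Metric.ball x δ ∩ interactionDomain Ω δ, (g y - u₀ x) * γ ‖y - x‖) ∧
    u = fun x => u₀ x + g x

end NonlocalCDG

end

/-! The argument is a Strang-type energy estimate in which every constant is uniform in `δ`. On the
enlarged domain `O`, write the error `e` (extension of `u₀` minus `u_δ^h`) as `w + ρ + e₂`. Here `w`
is the nodal interpolant minus the discrete solution on `Ω`, an admissible test function; `ρ` is the
interpolation error on `Ω`; and `e₂` is the data error on the interaction domain.

Consistency: by symmetry and the normalized second moment, the nonlocal operator of a `C^4` function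
differs from its Laplacian by `O(δ²)` (`abs_two_mul_integral_sub_laplacian_le`). Combined with
nonlocal integration by parts and the Galerkin equations, this bounds the energy form of `e` against
`w` by `T ∫ |w|` with `T = O(δ²)` (`energyForm_error_le`). Stability: a Poincaré inequality whose
constant is independent of the kernel controls `w` in `L²(Ω)` by its energy. Young's inequality then
bounds the energy of `e` by that of `ρ + e₂` plus a multiple of `T²` (`energy_error_le`).

Remainder: the energy is at most `4 G` times the squared `L²` norm, with `G = O(δ⁻²)`. As `ρ =
O(h²)`, its energy is `O(δ⁻² h⁴)`. As `e₂ = O(δ^(2+μ) + h²)` lives on a collar of measure `O(δ)`,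
its energy is `O(δ^(3+2μ) + δ⁻¹ h⁴)`. With `T² = O(δ⁴)` and `μ ∈ {0, 1}` the total is `O(δ^(3+μ) +
δ⁻² h⁴)`, and square roots give the energy rate. For the `L²` rate, Poincaré is applied to `e - e₂`,
which vanishes outside `Ω` and equals `e` on it. -/

namespace NonlocalCDG

/-! ### Geometry of the polyhedron: its boundary collar has measure `O(δ)`. -/

section Geometry

variable {d : ℕ}

lemma IsOpenPolyhedron.isOpen {Ω : Set (E d)} (hΩ : IsOpenPolyhedron Ω) : IsOpen Ω := by
  obtain ⟨-, K, -, rfl⟩ := hΩ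
  exact isOpen_interior

lemma isCompact_space {K : Geometry.SimplicialComplex ℝ (E d)} (hK : K.faces.Finite) :
    IsCompact K.space :=
  hK.isCompact_biUnion fun s _ => s.finite_toSet.isCompact_convexHull ℝ

lemma IsOpenPolyhedron.isBounded {Ω : Set (E d)} (hΩ : IsOpenPolyhedron Ω) :
    Bornology.IsBounded Ω := by
  obtain ⟨-, K, hK, rfl⟩ := hΩ
  exact (isCompact_space hK).isBounded.subset interior_subset

lemma IsOpenPolyhedron.frontier_nonempty {Ω : Set (E d)} (hd : 1 ≤ d) (hΩ : IsOpenPolyhedron Ω) :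
    (frontier Ω).Nonempty := by
  have : Nonempty (Fin d) := ⟨⟨0, hd⟩⟩
  refine nonempty_frontier_iff.2 ⟨hΩ.1, fun h => ?_⟩
  exact NormedSpace.unbounded_univ ℝ (E d) (h ▸ hΩ.isBounded)

/-- An affine independent family spans a simplex whose boundary lies in finitely many
hyperplanes. -/
lemma exists_hyperplanes_of_affineIndependent (s : Finset (E d))
    (hs : AffineIndependent ℝ ((↑) : s → E d)) :
    ∃ T : Set (E d →ᵃ[ℝ] ℝ), T.Finite ∧ (∀ A ∈ T, A.linear ≠ 0) ∧
      convexHull ℝ (s : Set (E d)) \ interior (convexHull ℝ (s : Set (E d))) ⊆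
        ⋃ A ∈ T, {x | A x = 0} := by
  obtain ⟨t, hst, hti, htop⟩ :=
    exists_subset_affineIndependent_affineSpan_eq_top (s := (s : Set (E d))) hs
  let b : AffineBasis t ℝ (E d) := ⟨(↑), hti, by rw [Subtype.range_coe, htop]⟩
  have hbr : range b = t := Subtype.range_coe
  have hfin : Finite t := b.finite
  refine ⟨{A | A ∈ range b.coord ∧ A.linear ≠ 0}, (finite_range _).subset fun A hA => hA.1,
    fun A hA => hA.2, ?_⟩
  rintro x ⟨hx, hxi⟩
  have hpos : ∀ i, 0 ≤ b.coord i x := by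
    have : x ∈ convexHull ℝ (range b) := by rw [hbr]; exact convexHull_mono hst hx
    rw [b.convexHull_eq_nonneg_coord] at this
    exact this
  obtain ⟨i, hi⟩ : ∃ i, b.coord i x = 0 := by
    -- For a full-dimensional simplex, a non-interior point has a vanishing barycentric coordinate.
    -- For a lower-dimensional one, the coordinate of any added basis vertex vanishes on the whole
    -- simplex.
    by_cases h : t ⊆ s
    · have hts : (s : Set (E d)) = range b := by rw [hbr]; exact hst.antisymm h
      rw [hts, b.interior_convexHull] at hxi
      simp only [mem_ofPred_eq, not_forall, not_lt] at hxi
      obtain ⟨i, hi⟩ := hxi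
      exact ⟨i, le_antisymm hi (hpos i)⟩
    · obtain ⟨p, hpt, hps⟩ := not_subset.1 h
      refine ⟨⟨p, hpt⟩, ?_⟩
      have hsub : convexHull ℝ (s : Set (E d)) ⊆ {y | b.coord ⟨p, hpt⟩ y = 0} := by
        refine convexHull_min (fun q hq => ?_) ?_
        · exact b.coord_apply_ne (i := ⟨p, hpt⟩) (j := ⟨q, hst hq⟩)
            fun h => hps (by rw [show p = q from congrArg Subtype.val h]; exact hq)
        · exact (convex_singleton (0 : ℝ)).affine_preimage (b.coord ⟨p, hpt⟩)
      exact hsub hx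
  refine mem_iUnion₂.2 ⟨b.coord i, ⟨mem_range_self i, fun h0 => ?_⟩, hi⟩
  -- With zero linear part the coordinate would be constant, yet it is 1 at its own vertex and 0 at
  -- `x`.
  have h1 : b.coord i (b i) = b.coord i x := by
    have := (b.coord i).linearMap_vsub (b i) x
    rw [h0] at this
    exact sub_eq_zero.1 this.symm
  rw [b.coord_apply_eq, hi] at h1
  exact one_ne_zero h1

lemma IsOpenPolyhedron.frontier_subset_hyperplanes {Ω : Set (E d)} (hΩ : IsOpenPolyhedron Ω) :
    ∃ T : Set (E d →ᵃ[ℝ] ℝ), T.Finite ∧ (∀ A ∈ T, A.linear ≠ 0) ∧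
      frontier Ω ⊆ ⋃ A ∈ T, {x | A x = 0} := by
  obtain ⟨-, K, hK, rfl⟩ := hΩ
  choose! T hTf hTn hT using fun (s : Finset (E d)) (hs : s ∈ K.faces) =>
    exists_hyperplanes_of_affineIndependent s (K.indep hs)
  refine ⟨⋃ s ∈ K.faces, T s, hK.biUnion hTf, fun A hA => ?_, fun x hx => ?_⟩
  · obtain ⟨s, hs, hA⟩ := mem_iUnion₂.1 hA
    exact hTn s hs A hA
  · have hxK : x ∈ K.space :=
      (isCompact_space hK).isClosed.closure_subset_iff.2 interior_subset hx.1
    have hxi : x ∉ interior K.space := by simpa using hx.2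
    obtain ⟨s, hs, hxs⟩ := K.mem_space_iff.1 hxK
    have := hT s hs ⟨hxs, fun h => hxi (interior_mono (K.convexHull_subset_space hs) h)⟩
    obtain ⟨A, hA, hAx⟩ := mem_iUnion₂.1 this
    exact mem_iUnion₂.2 ⟨A, mem_iUnion₂.2 ⟨s, hs, hA⟩, hAx⟩

/-- The part of a slab of width `r` in a ball has measure `O(r)`: it has `⌈1 / r⌉` disjoint
translates in a larger ball. -/
lemma volume_slab_le (A : E d →ᵃ[ℝ] ℝ) (hA : A.linear ≠ 0) (R r₀ : ℝ) :
    ∃ V : ℝ, 0 ≤ V ∧ ∀ r, 0 < r → r ≤ r₀ →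
      volume {x : E d | ‖x‖ < R ∧ |A x| < r} ≤ ENNReal.ofReal (V * r) := by
  obtain ⟨v, hv⟩ : ∃ v, A.linear v = 1 := by
    obtain ⟨v, hv⟩ : ∃ v, A.linear v ≠ 0 := by
      by_contra! h
      exact hA (LinearMap.ext h)
    exact ⟨(A.linear v)⁻¹ • v, by simp [hv]⟩
  have hAc : Continuous A := A.continuous_of_finiteDimensional
  -- The longest translation used is at most `2 * r * N * ‖v‖`, and `N * r ≤ 1 + r₀`; this fixes the
  -- radius.
  set V := (volume : Measure (E d)).real (Metric.ball 0 (R + 2 * (1 + r₀) * ‖v‖)) with hV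
  refine ⟨V, measureReal_nonneg, fun r hr hr₀ => ?_⟩
  set S := {x : E d | ‖x‖ < R ∧ |A x| < r}
  have hS : MeasurableSet S :=
    ((isOpen_lt continuous_norm continuous_const).inter
      (isOpen_lt hAc.abs continuous_const)).measurableSet
  set N := ⌈1 / r⌉₊
  -- Since `A v` grows at unit rate, steps of `2 * r` along `v`, the full width of the slab, make
  -- the translates disjoint.
  let t : ℕ → Set (E d) := fun k => (fun x => x + (2 * r * k) • v) ⁻¹' S
  have hAt : ∀ x (c : ℝ), A (x + c • v) = A x + c := by
    intro x c
    have := A.map_vadd x (c • v)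
    simp only [vadd_eq_add, map_smul, hv, smul_eq_mul, mul_one] at this
    rw [add_comm x, this, add_comm]
  have hvol : ∀ k, volume (t k) = volume S := fun k => measure_preimage_add_right _ _ _
  have hmeas : ∀ k, MeasurableSet (t k) := fun k => (measurable_add_const _) hS
  have hdisj : Pairwise (Function.onFun Disjoint t) := by
    intro k l hkl
    refine Set.disjoint_left.2 fun x hk hl => hkl ?_
    have h1 : |A x + 2 * r * k| < r := by rw [← hAt]; exact hk.2
    have h2 : |A x + 2 * r * l| < r := by rw [← hAt]; exact hl.2
    rw [abs_lt] at h1 h2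
    have h3 : (k : ℝ) < l + 1 := by
      by_contra! h
      nlinarith
    have h4 : (l : ℝ) < k + 1 := by
      by_contra! h
      nlinarith
    have h3' : k < l + 1 := by exact_mod_cast h3
    have h4' : l < k + 1 := by exact_mod_cast h4
    omega
  have hN : (N : ℝ) * r ≤ 1 + r₀ := by
    have := (Nat.ceil_lt_add_one (by positivity : 0 ≤ 1 / r)).le
    calc (N : ℝ) * r ≤ (1 / r + 1) * r := by gcongr
      _ = 1 + r := by field_simp
      _ ≤ 1 + r₀ := by linarith
  have hN1 : 1 ≤ (N : ℝ) * r := by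
    calc 1 = 1 / r * r := by field_simp
      _ ≤ N * r := by gcongr; exact Nat.le_ceil _
  have hsub : ⋃ k ∈ Finset.range N, t k ⊆ Metric.ball 0 (R + 2 * (1 + r₀) * ‖v‖) := by
    refine iUnion₂_subset fun k hk x hx => ?_
    rw [mem_ball_zero_iff]
    have hk' : (k : ℝ) ≤ N := by exact_mod_cast (Finset.mem_range.1 hk).le
    have h1 : ‖x‖ ≤ ‖x + (2 * r * k) • v‖ + ‖(2 * r * k) • v‖ := by
      simpa using norm_sub_le (x + (2 * r * k) • v) ((2 * r * k) • v)
    have h2 : ‖(2 * r * k) • v‖ ≤ 2 * (1 + r₀) * ‖v‖ := by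
      rw [norm_smul, Real.norm_of_nonneg (by positivity)]
      gcongr ?_ * _
      nlinarith
    have h3 : ‖x + (2 * r * k) • v‖ < R := hx.1
    linarith
  have hle : (N : ℝ≥0∞) * volume S ≤ ENNReal.ofReal V := by
    calc (N : ℝ≥0∞) * volume S = volume (⋃ k ∈ Finset.range N, t k) := by
          rw [measure_biUnion_finset (fun i _ j _ h => hdisj h) fun k _ => hmeas k]
          simp [hvol]
      _ ≤ _ := measure_mono hsub
      _ = ENNReal.ofReal V := by
          rw [hV, Measure.real, ENNReal.ofReal_toReal measure_ball_lt_top.ne]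
  calc volume S = 1 * volume S := (one_mul _).symm
    _ ≤ (ENNReal.ofReal r * N) * volume S := by
        gcongr
        rw [← ENNReal.ofReal_natCast, ← ENNReal.ofReal_mul hr.le]
        exact ENNReal.one_le_ofReal.2 (by linarith)
    _ ≤ ENNReal.ofReal r * ENNReal.ofReal V := by rw [mul_assoc]; gcongr
    _ = ENNReal.ofReal (V * r) := by rw [← ENNReal.ofReal_mul hr.le, mul_comm]

lemma volume_hyperplane_neighborhood_le (A : E d →ᵃ[ℝ] ℝ) (hA : A.linear ≠ 0) (R δ₀ : ℝ) :
    ∃ V : ℝ, 0 ≤ V ∧ ∀ δ, 0 < δ → δ ≤ δ₀ →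
      volume {x : E d | ‖x‖ < R ∧ ∃ p, A p = 0 ∧ dist x p < δ} ≤ ENNReal.ofReal (V * δ) := by
  set L : E d →L[ℝ] ℝ := LinearMap.toContinuousLinearMap A.linear
  obtain ⟨V, hV, h⟩ := volume_slab_le A hA R ((‖L‖ + 1) * δ₀)
  refine ⟨V * (‖L‖ + 1), by positivity, fun δ hδ hδ₀ => ?_⟩
  refine (measure_mono ?_).trans ((h ((‖L‖ + 1) * δ) (by positivity) (by gcongr)).trans_eq ?_)
  · rintro x ⟨hx, p, hp, hxp⟩
    refine ⟨hx, ?_⟩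
    have h1 : A x = L (x - p) := by
      have := A.linearMap_vsub x p
      rw [hp] at this
      simpa [L] using this.symm
    calc |A x| = ‖L (x - p)‖ := by rw [h1, Real.norm_eq_abs]
      _ ≤ ‖L‖ * ‖x - p‖ := L.le_opNorm _
      _ ≤ ‖L‖ * δ := by gcongr; rw [← dist_eq_norm]; exact hxp.le
      _ < (‖L‖ + 1) * δ := by linarith
  · rw [mul_assoc]

lemma frontier_subset_interactionDomain {Ω : Set (E d)} (hΩ : IsOpen Ω) {δ : ℝ} (hδ : 0 < δ) :
    frontier Ω ⊆ interactionDomain Ω δ := fun x hx =>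
  ⟨by rw [hΩ.frontier_eq] at hx; exact hx.2, by rwa [Metric.infDist_zero_of_mem hx]⟩

/-- A point outside `Ω` is as far from `∂Ω` as from `Ω`. Hence at points of `Ω` the nonlocal
operator sees the full ball, so the symmetry of the kernel can be exploited. -/
lemma ball_subset_enlargedDomain {Ω : Set (E d)} {δ : ℝ} {x : E d} (hx : x ∈ Ω) :
    Metric.ball x δ ⊆ enlargedDomain Ω δ := by
  intro y hy
  by_cases hyΩ : y ∈ Ω
  · exact Or.inl hyΩ
  · refine Or.inr ⟨hyΩ, ?_⟩
    obtain ⟨p, hp, hd⟩ := exists_mem_frontier_infDist_compl_eq_dist (x := y) (s := Ωᶜ) hyΩ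
      (fun h => (h ▸ mem_univ x : x ∈ Ωᶜ) hx)
    rw [frontier_compl] at hp
    rw [compl_compl] at hd
    calc Metric.infDist y (frontier Ω) ≤ dist y p := Metric.infDist_le_dist_of_mem hp
      _ = Metric.infDist y Ω := hd.symm
      _ ≤ dist y x := Metric.infDist_le_dist_of_mem hx
      _ < δ := hy

lemma measurableSet_interactionDomain {Ω : Set (E d)} (hΩ : IsOpen Ω) (δ : ℝ) :
    MeasurableSet (interactionDomain Ω δ) :=
  hΩ.measurableSet.compl.inter
    (isOpen_lt (Metric.continuous_infDist_pt _) continuous_const).measurableSet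

lemma measurableSet_enlargedDomain {Ω : Set (E d)} (hΩ : IsOpen Ω) (δ : ℝ) :
    MeasurableSet (enlargedDomain Ω δ) :=
  hΩ.measurableSet.union (measurableSet_interactionDomain hΩ δ)

/-- The collar is covered by the `δ`-neighborhoods of finitely many hyperplanes, cut off by a fixed
ball. This factor `δ` is what gains half a power in the data error. -/
lemma IsOpenPolyhedron.volume_interactionDomain_le {Ω : Set (E d)} (hd : 1 ≤ d)
    (hΩ : IsOpenPolyhedron Ω) (δ₀ : ℝ) :
    ∃ V : ℝ, 0 ≤ V ∧ ∀ δ, 0 < δ → δ ≤ δ₀ →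
      volume (interactionDomain Ω δ) ≤ ENNReal.ofReal (V * δ) := by
  obtain ⟨T, hTf, hTn, hT⟩ := hΩ.frontier_subset_hyperplanes
  obtain ⟨R, hR⟩ : ∃ R, ∀ x ∈ frontier Ω, ‖x‖ ≤ R :=
    (hΩ.isBounded.closure.subset frontier_subset_closure).exists_norm_le
  choose! V hV h using fun (A : E d →ᵃ[ℝ] ℝ) (hA : A ∈ T) =>
    volume_hyperplane_neighborhood_le A (hTn A hA) (R + δ₀) δ₀
  have hV' : ∀ A ∈ hTf.toFinset, 0 ≤ V A := fun A hA => hV A (hTf.mem_toFinset.1 hA)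
  refine ⟨∑ A ∈ hTf.toFinset, V A, Finset.sum_nonneg hV', fun δ hδ hδ₀ => ?_⟩
  calc volume (interactionDomain Ω δ)
      ≤ volume (⋃ A ∈ hTf.toFinset, {x | ‖x‖ < R + δ₀ ∧ ∃ p, A p = 0 ∧ dist x p < δ}) := by
        refine measure_mono fun y hy => ?_
        obtain ⟨p, hp, hyp⟩ := (Metric.infDist_lt_iff (hΩ.frontier_nonempty hd)).1 hy.2
        obtain ⟨A, hA, hAp⟩ := mem_iUnion₂.1 (hT hp)
        refine mem_iUnion₂.2 ⟨A, hTf.mem_toFinset.2 hA, ?_, p, hAp, hyp⟩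
        have := norm_le_norm_add_norm_sub' y p
        rw [← dist_eq_norm] at this
        linarith [hR p hp]
    _ ≤ ∑ A ∈ hTf.toFinset, volume {x | ‖x‖ < R + δ₀ ∧ ∃ p, A p = 0 ∧ dist x p < δ} :=
        measure_biUnion_finset_le _ _
    _ ≤ ∑ A ∈ hTf.toFinset, ENNReal.ofReal (V A * δ) :=
        Finset.sum_le_sum fun A hA => h A (hTf.mem_toFinset.1 hA) δ hδ hδ₀
    _ = ENNReal.ofReal ((∑ A ∈ hTf.toFinset, V A) * δ) := by
        rw [← ENNReal.ofReal_sum_of_nonneg fun A hA => mul_nonneg (hV' A hA) hδ.le,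
          Finset.sum_mul]

end Geometry

/-! ### Piecewise linear interpolation and its second order error. -/

section Interpolation

variable {d : ℕ}

lemma exists_affineMap_eqOn (s : Finset (E d)) (hs : AffineIndependent ℝ ((↑) : s → E d))
    (f : E d → ℝ) : ∃ A : E d →ᵃ[ℝ] ℝ, ∀ p ∈ s, A p = f p := by
  classical
  obtain ⟨t, hst, hti, htop⟩ :=
    exists_subset_affineIndependent_affineSpan_eq_top (s := (s : Set (E d))) hs
  let b : AffineBasis t ℝ (E d) := ⟨(↑), hti, by rw [Subtype.range_coe, htop]⟩
  have hfin : Finite t := b.finite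
  have := Fintype.ofFinite t
  refine ⟨(Fintype.linearCombination ℝ (fun i : t => f i)).toAffineMap.comp b.coords,
    fun p hp => ?_⟩
  have h : ∀ i, b.coord i p = if i = ⟨p, hst hp⟩ then 1 else 0 :=
    fun i => b.coord_apply i ⟨p, hst hp⟩
  simp [Fintype.linearCombination_apply, AffineBasis.coords_apply, h]

/-- Two simplices of the complex meet inside the hull of their common vertices, where the affine
interpolants agree because they agree at those vertices. So the choice of a simplex containing `x`
is immaterial. -/
lemma exists_isPiecewiseLinear (K : Geometry.SimplicialComplex ℝ (E d)) (f : E d → ℝ) :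
    ∃ v, IsPiecewiseLinear K v ∧ ∀ p ∈ K.vertices, v p = f p := by
  classical
  choose! A hA using fun (s : Finset (E d)) (hs : s ∈ K.faces) =>
    exists_affineMap_eqOn s (K.indep hs) f
  let v : E d → ℝ := fun x =>
    if h : ∃ s ∈ K.faces, x ∈ convexHull ℝ (s : Set (E d)) then A h.choose x else 0
  have hv : ∀ s ∈ K.faces, EqOn v (A s) (convexHull ℝ (s : Set (E d))) := by
    intro s hs x hx
    have h : ∃ s ∈ K.faces, x ∈ convexHull ℝ (s : Set (E d)) := ⟨s, hs, hx⟩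
    simp only [v, dif_pos h]
    set t := h.choose
    obtain ⟨ht, hxt⟩ : t ∈ K.faces ∧ x ∈ convexHull ℝ (t : Set (E d)) := h.choose_spec
    have hx' := K.inter_subset_convexHull ht hs ⟨hxt, hx⟩
    have hsub : convexHull ℝ (t ∩ s : Set (E d)) ⊆ (A t - A s) ⁻¹' {0} := by
      refine convexHull_min (fun p hp => ?_) ((convex_singleton (0 : ℝ)).affine_preimage _)
      simp [hA t ht p hp.1, hA s hs p hp.2]
    have : A t x - A s x = 0 := by simpa using hsub hx'
    linarith
  refine ⟨v, fun s hs => ⟨A s, hv s hs⟩, fun p hp => ?_⟩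
  have hp' : {p} ∈ K.faces := hp
  rw [hv {p} hp' (by simp), hA {p} hp' p (by simp)]

lemma IsPiecewiseLinear.sub {K : Geometry.SimplicialComplex ℝ (E d)} {v w : E d → ℝ}
    (hv : IsPiecewiseLinear K v) (hw : IsPiecewiseLinear K w) :
    IsPiecewiseLinear K fun x => v x - w x := by
  intro s hs
  obtain ⟨A, hA⟩ := hv s hs
  obtain ⟨B, hB⟩ := hw s hs
  exact ⟨A - B, fun x hx => by simp [hA hx, hB hx]⟩

lemma IsPiecewiseLinear.continuousOn {K : Geometry.SimplicialComplex ℝ (E d)} {v : E d → ℝ}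
    (hK : K.faces.Finite) (hv : IsPiecewiseLinear K v) : ContinuousOn v K.space := by
  have := hK.to_subtype
  have h : K.space = ⋃ s : K.faces, convexHull ℝ ((s : Finset (E d)) : Set (E d)) := by
    rw [Geometry.SimplicialComplex.space, biUnion_eq_iUnion]
  rw [h]
  refine (locallyFinite_of_finite _).continuousOn_iUnion
    (fun s => (s.1.finite_toSet.isCompact_convexHull ℝ).isClosed) fun s => ?_
  obtain ⟨A, hA⟩ := hv s s.2
  exact A.continuous_of_finiteDimensional.continuousOn.congr hA

/-- Bounded measurable real functions. -/
def IsBM {X : Type*} [MeasurableSpace X] (φ : X → ℝ) : Prop :=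
  Measurable φ ∧ ∃ C, ∀ x, |φ x| ≤ C

lemma isBM_indicator {S : Set (E d)} (hS : MeasurableSet S) {φ : E d → ℝ} (hφ : ContinuousOn φ S)
    {C : ℝ} (hC : ∀ x ∈ S, |φ x| ≤ C) : IsBM (S.indicator φ) := by
  classical
  refine ⟨?_, max C 0, fun x => ?_⟩
  · rw [← piecewise_eq_indicator]
    exact hφ.measurable_piecewise continuousOn_const hS
  · by_cases hx : x ∈ S
    · simp [hx, hC x hx]
    · simp [hx]

lemma IsPiecewiseLinear.isBM_indicator {K : Geometry.SimplicialComplex ℝ (E d)} {v : E d → ℝ}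
    (hK : K.faces.Finite) (hv : IsPiecewiseLinear K v) {S : Set (E d)} (hS : MeasurableSet S)
    (hSK : S ⊆ K.space) : IsBM (S.indicator v) := by
  obtain ⟨C, hC⟩ := (isCompact_space hK).exists_bound_of_continuousOn (hv.continuousOn hK)
  exact NonlocalCDG.isBM_indicator hS ((hv.continuousOn hK).mono hSK) fun x hx => hC x (hSK hx)

/-- First order Taylor estimate on a convex set. -/
lemma abs_sub_sub_fderiv_le {U S : Set (E d)} (hU : IsOpen U) (hS : Convex ℝ S) (hSU : S ⊆ U)
    {φ : E d → ℝ} (hφ : ContDiffOn ℝ 2 φ U) {M : ℝ}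
    (hM : ∀ x ∈ U, ‖iteratedFDeriv ℝ 2 φ x‖ ≤ M) {x p : E d} (hx : x ∈ S) (hp : p ∈ S) :
    |φ p - φ x - fderiv ℝ φ x (p - x)| ≤ M * ‖p - x‖ ^ 2 := by
  have hM0 : 0 ≤ M := (norm_nonneg _).trans (hM x (hSU hx))
  have hat : ∀ y ∈ U, ContDiffAt ℝ 2 φ y := fun y hy => hφ.contDiffAt (hU.mem_nhds hy)
  have h1 : ∀ y ∈ S, ‖fderiv ℝ φ y - fderiv ℝ φ x‖ ≤ M * ‖y - x‖ := by
    intro y hy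
    refine hS.norm_image_sub_le_of_norm_fderiv_le (𝕜 := ℝ) (fun z hz => ?_) (fun z hz => ?_) hx hy
    · exact ((hat z (hSU hz)).fderiv_right (m := 1) (by norm_num)).differentiableAt (by norm_num)
    · rw [← norm_iteratedFDeriv_one, norm_iteratedFDeriv_fderiv]
      exact hM z (hSU hz)
  have hseg : segment ℝ x p ⊆ S := hS.segment_subset hx hp
  have := (convex_segment x p).norm_image_sub_le_of_norm_hasFDerivWithin_le' (𝕜 := ℝ) (f := φ)
    (f' := fun y => fderiv ℝ φ y) (φ := fderiv ℝ φ x) (C := M * ‖p - x‖)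
    (fun y hy => ((hat y (hSU (hseg hy))).differentiableAt
      (by norm_num)).hasFDerivAt.hasFDerivWithinAt)
    (fun y hy => (h1 y (hseg hy)).trans (by
      gcongr
      rw [← dist_eq_norm, ← dist_eq_norm, dist_comm y, dist_comm p]
      have := dist_add_dist_of_mem_segment hy
      linarith [dist_nonneg (x := y) (y := p)]))
    (left_mem_segment ℝ x p) (right_mem_segment ℝ x p)
  rw [Real.norm_eq_abs] at this
  linarith [sq ‖p - x‖]

/-- Piecewise linear interpolation is second order accurate, up to the error at the nodes. -/
lemma IsPiecewiseLinear.abs_sub_le {K : Geometry.SimplicialComplex ℝ (E d)} {D U : Set (E d)}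
    {h : ℝ} (hK : IsTriangulation K D h) {v : E d → ℝ} (hv : IsPiecewiseLinear K v)
    (hU : IsOpen U) (hDU : D ⊆ U) {φ : E d → ℝ} (hφ : ContDiffOn ℝ 2 φ U) {M : ℝ}
    (hM : ∀ x ∈ U, ‖iteratedFDeriv ℝ 2 φ x‖ ≤ M) {ε : ℝ}
    (hε : ∀ p ∈ K.vertices, |v p - φ p| ≤ ε) {x : E d} (hx : x ∈ D) :
    |v x - φ x| ≤ ε + M * h ^ 2 := by
  have hM0 : 0 ≤ M := (norm_nonneg _).trans (hM x (hDU hx))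
  rw [← hK.space_eq, Geometry.SimplicialComplex.mem_space_iff] at hx
  obtain ⟨s, hs, hxs⟩ := hx
  obtain ⟨A, hA⟩ := hv s hs
  have hsU : convexHull ℝ (s : Set (E d)) ⊆ U :=
    (K.convexHull_subset_space hs).trans (hK.space_eq.subset.trans hDU)
  -- The Taylor expansion is centred at the evaluation point `x`. It puts `B` within `c` of `k` at
  -- each vertex, and convexity carries this to `x`. No gradient of the interpolant is estimated, so
  -- no shape regularity is needed.
  let B : E d →ᵃ[ℝ] ℝ := A - (fderiv ℝ φ x).toLinearMap.toAffineMap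
  set c := ε + M * h ^ 2
  set k := φ x - fderiv ℝ φ x x
  have hsub : convexHull ℝ (s : Set (E d)) ⊆ B ⁻¹' Icc (k - c) (k + c) := by
    refine convexHull_min (fun p hp => ?_) ((convex_Icc _ _).affine_preimage _)
    have hps := subset_convexHull ℝ (s : Set (E d)) hp
    have hpv : p ∈ K.vertices := K.down_closed hs (by simpa using hp) (Finset.singleton_nonempty p)
    have h1 := hε p hpv
    have h2 := abs_sub_sub_fderiv_le hU (convex_convexHull ℝ (s : Set (E d))) hsU hφ hM hxs hps
    have h3 : ‖p - x‖ ≤ h := by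
      rw [← dist_eq_norm]
      exact (Metric.dist_le_diam_of_mem
        (s.finite_toSet.isCompact_convexHull ℝ).isBounded hps hxs).trans (hK.diam_le s hs)
    have h4 : M * ‖p - x‖ ^ 2 ≤ M * h ^ 2 := by gcongr
    rw [hA hps] at h1
    rw [map_sub] at h2
    rw [abs_le] at h1 h2
    have hB : B p = A p - fderiv ℝ φ x p := by simp [B]
    simp only [mem_preimage, hB, mem_Icc, c, k]
    constructor <;> linarith
  have hB : B x = A x - fderiv ℝ φ x x := by simp [B]
  have := hsub hxs
  simp only [mem_preimage, hB, mem_Icc, k] at this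
  rw [hA hxs, abs_le]
  constructor <;> linarith

end Interpolation

/-! ### Radial kernels: moments and consistency with the Laplacian. -/

section Kernel

variable {d : ℕ}

/-- A normalized radial interaction kernel on `ℝ^d` with horizon `δ` and total mass at most `G`. -/
structure IsRadialKernel (d : ℕ) (δ G : ℝ) (k : E d → ℝ) : Prop where
  measurable : Measurable k
  nonneg : ∀ z, 0 ≤ k z
  eq_zero : ∀ z, δ ≤ ‖z‖ → k z = 0
  map_isometry : ∀ (e : E d ≃ₗᵢ[ℝ] E d) z, k (e z) = k z
  integrable : Integrable k
  mass_le : ∫ z, k z ≤ G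
  moment : ∫ z, ‖z‖ ^ 2 * k z = d

/-- The kernel `z ↦ γ ‖z‖`, cut off outside the open ball of radius `δ`. -/
noncomputable def cutKernel (d : ℕ) (δ : ℝ) (γ : ℝ → ℝ) : E d → ℝ :=
  (Metric.ball 0 δ).indicator fun z => γ ‖z‖

lemma cutKernel_of_lt {δ : ℝ} {γ : ℝ → ℝ} {z : E d} (h : ‖z‖ < δ) :
    cutKernel d δ γ z = γ ‖z‖ :=
  indicator_of_mem (mem_ball_zero_iff.2 h) _

lemma cutKernel_of_le {δ : ℝ} {γ : ℝ → ℝ} {z : E d} (h : δ ≤ ‖z‖) : cutKernel d δ γ z = 0 :=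
  indicator_of_notMem (fun hz => (mem_ball_zero_iff.1 hz).not_ge h) _

/-- Polar coordinates: the weight `s ^ (d - 1)` times `s ^ 2` is `s ^ (d + 1)`, which uses `1 ≤ d`.
-/
lemma cutKernel_moment (hd : 1 ≤ d) (δ : ℝ) (γ : ℝ → ℝ) :
    ∫ z, ‖z‖ ^ 2 * cutKernel d δ γ z =
      sphereArea d * ∫ s in Ioo 0 δ, s ^ (d + 1) * γ s := by
  have : Nonempty (Fin d) := ⟨⟨0, hd⟩⟩
  have h1 : ∀ z : E d, ‖z‖ ^ 2 * cutKernel d δ γ z =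
      (fun s => s ^ 2 * (Iio δ).indicator γ s) ‖z‖ := by
    intro z
    by_cases h : ‖z‖ < δ
    · simp [cutKernel_of_lt h, h]
    · simp [cutKernel_of_le (not_lt.1 h), h]
  simp_rw [h1]
  rw [integral_fun_norm_addHaar (volume : Measure (E d)) fun s => s ^ 2 * (Iio δ).indicator γ s,
    sphereArea, Measure.toSphere_real_apply_univ]
  simp only [finrank_euclideanSpace, Fintype.card_fin, nsmul_eq_mul, smul_eq_mul, mul_assoc]
  congr 2
  rw [← Iio_inter_Ioi, ← Measure.restrict_restrict measurableSet_Iio,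
    ← integral_indicator (μ := volume.restrict (Ioi 0)) measurableSet_Iio]
  congr 1 with s
  by_cases h : s < δ
  · have hd' : d + 1 = (d - 1) + 2 := by omega
    simp [h, hd', pow_add, mul_assoc]
  · simp [h]

/-- One point of `Ω` suffices for the mass bound: its ball lies in the enlarged domain, so the
supremum `kernelMass` dominates the whole mass of the kernel. -/
lemma IsKernelProfile.isRadialKernel {δ : ℝ} {γ : ℝ → ℝ} (hd : 1 ≤ d)
    (hγ : IsKernelProfile d δ γ) {Ω : Set (E d)} (hΩ : Ω.Nonempty) {G : ℝ} (hG0 : 0 ≤ G)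
    (hG : kernelMass Ω δ γ ≤ ENNReal.ofReal G) : IsRadialKernel d δ G (cutKernel d δ γ) := by
  have hmeas : Measurable (cutKernel d δ γ) :=
    (hγ.measurable.comp measurable_norm).indicator measurableSet_ball
  have hnn : ∀ z, 0 ≤ cutKernel d δ γ z := fun z =>
    indicator_nonneg (fun z _ => hγ.nonneg _ (norm_nonneg z)) z
  have hle : ∫⁻ z, ENNReal.ofReal (cutKernel d δ γ z) ≤ ENNReal.ofReal G := by
    obtain ⟨x, hx⟩ := hΩ
    calc ∫⁻ z, ENNReal.ofReal (cutKernel d δ γ z)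
        = ∫⁻ y, ENNReal.ofReal (cutKernel d δ γ (y - x)) :=
          (lintegral_sub_right_eq_self (fun z => ENNReal.ofReal (cutKernel d δ γ z)) x).symm
      _ = ∫⁻ y in Metric.ball x δ ∩ enlargedDomain Ω δ, ENNReal.ofReal (γ ‖y - x‖) := by
          rw [inter_eq_left.2 (ball_subset_enlargedDomain hx),
            ← lintegral_indicator measurableSet_ball]
          congr 1 with y
          by_cases h : ‖y - x‖ < δ
          · simp [cutKernel_of_lt h, dist_eq_norm, h]
          · simp [cutKernel_of_le (not_lt.1 h), dist_eq_norm, h]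
      _ ≤ kernelMass Ω δ γ := by
          rw [kernelMass]
          exact le_iSup₂ (f := fun x (_ : x ∈ enlargedDomain Ω δ) =>
            ∫⁻ y in Metric.ball x δ ∩ enlargedDomain Ω δ, ENNReal.ofReal (γ ‖y - x‖)) x (Or.inl hx)
      _ ≤ ENNReal.ofReal G := hG
  refine ⟨hmeas, hnn, fun z => cutKernel_of_le, fun e z => ?_, ?_, ?_, ?_⟩
  · by_cases h : ‖z‖ < δ
    · rw [cutKernel_of_lt h, cutKernel_of_lt (by simpa using h), e.norm_map]
    · rw [cutKernel_of_le (not_lt.1 h), cutKernel_of_le (by simpa using h)]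
  · refine ⟨hmeas.aestronglyMeasurable, ?_⟩
    rw [hasFiniteIntegral_iff_ofReal (ae_of_all _ hnn)]
    exact hle.trans_lt ENNReal.ofReal_lt_top
  · rw [integral_eq_lintegral_of_nonneg_ae (ae_of_all _ hnn) hmeas.aestronglyMeasurable]
    exact ENNReal.toReal_le_of_le_ofReal hG0 hle
  · rw [cutKernel_moment hd, hγ.moment]

namespace IsRadialKernel

variable {δ G : ℝ} {k : E d → ℝ}

lemma map_neg (hk : IsRadialKernel d δ G k) (z : E d) : k (-z) = k z :=
  hk.map_isometry (LinearIsometryEquiv.neg ℝ) z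

lemma integrable_bdd_mul (hk : IsRadialKernel d δ G k) {φ : E d → ℝ} (hφ : IsBM φ) :
    Integrable fun z => φ z * k z := by
  obtain ⟨hm, C, hC⟩ := hφ
  exact hk.integrable.bdd_mul hm.aestronglyMeasurable (ae_of_all _ hC)

lemma integrable_mul_of_le (hk : IsRadialKernel d δ G k) {φ : E d → ℝ} (hφ : Measurable φ)
    {C : ℝ} (hC : ∀ z, ‖z‖ < δ → |φ z| ≤ C) : Integrable fun z => φ z * k z := by
  refine (hk.integrable.const_mul C).mono' (hφ.mul hk.measurable).aestronglyMeasurable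
    (ae_of_all _ fun z => ?_)
  rw [norm_mul, Real.norm_of_nonneg (hk.nonneg z)]
  rcases lt_or_ge ‖z‖ δ with h | h
  · exact mul_le_mul_of_nonneg_right (hC z h) (hk.nonneg z)
  · simp [hk.eq_zero z h]

lemma integral_comp_isometry (hk : IsRadialKernel d δ G k) (e : E d ≃ₗᵢ[ℝ] E d) (φ : E d → ℝ) :
    ∫ z, φ (e z) * k z = ∫ z, φ z * k z := by
  rw [← e.measurePreserving.integral_comp e.toHomeomorph.measurableEmbedding fun z => φ z * k z]
  simp [hk.map_isometry]

lemma integral_comp_neg (hk : IsRadialKernel d δ G k) (φ : E d → ℝ) :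
    ∫ z, φ (-z) * k z = ∫ z, φ z * k z :=
  hk.integral_comp_isometry (LinearIsometryEquiv.neg ℝ) φ

lemma abs_coord_le (z : E d) (i : Fin d) : |z i| ≤ ‖z‖ := by
  simpa using PiLp.norm_apply_le z i

lemma integrable_coord_mul_coord (hk : IsRadialKernel d δ G k) (i j : Fin d) :
    Integrable fun z => z i * z j * k z := by
  refine hk.integrable_mul_of_le (C := δ * δ) (by fun_prop) fun z hz => ?_
  rw [abs_mul]
  have h1 := abs_coord_le z i
  have h2 := abs_coord_le z j
  gcongr <;> linarith [norm_nonneg z]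

/-- Reflecting the `i`-th coordinate preserves the kernel and changes the sign of the integrand. -/
lemma integral_coord_mul_coord_of_ne (hk : IsRadialKernel d δ G k) {i j : Fin d} (h : i ≠ j) :
    ∫ z, z i * z j * k z = 0 := by
  classical
  let e : E d ≃ₗᵢ[ℝ] E d := LinearIsometryEquiv.piLpCongrRight 2 fun m =>
    if m = i then LinearIsometryEquiv.neg ℝ else LinearIsometryEquiv.refl ℝ ℝ
  have h1 := hk.integral_comp_isometry e fun z => z i * z j
  have h2 : ∀ z, e z i * e z j = -(z i * z j) := by
    intro z
    simp [e, h.symm]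
  simp_rw [h2, neg_mul, integral_neg] at h1
  linarith

lemma integral_coord_sq_eq (hk : IsRadialKernel d δ G k) (i j : Fin d) :
    ∫ z, z i * z i * k z = ∫ z, z j * z j * k z := by
  let e : E d ≃ₗᵢ[ℝ] E d := LinearIsometryEquiv.piLpCongrLeft 2 ℝ ℝ (Equiv.swap i j)
  rw [← hk.integral_comp_isometry e fun z => z i * z i]
  have h2 : ∀ z, e z i = z j := by
    intro z
    simp [e, LinearIsometryEquiv.piLpCongrLeft_apply, Equiv.piCongrLeft'_apply]
  simp_rw [h2]

/-- Reflections kill the off-diagonal entries, coordinate swaps make the diagonal ones equal, and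
the normalization fixes the trace at `d`. -/
lemma integral_coord_mul_coord (hk : IsRadialKernel d δ G k) (i j : Fin d) :
    ∫ z, z i * z j * k z = if i = j then 1 else 0 := by
  split_ifs with h
  · subst h
    have h1 : ∑ j : Fin d, ∫ z, z j * z j * k z = d := by
      rw [← integral_finsetSum _ fun j _ => hk.integrable_coord_mul_coord j j, ← hk.moment]
      congr 1 with z
      rw [EuclideanSpace.real_norm_sq_eq, Finset.sum_mul]
      simp [sq]
    rw [Finset.sum_congr rfl fun j _ => hk.integral_coord_sq_eq j i] at h1
    simp only [Finset.sum_const, Finset.card_univ, Fintype.card_fin, nsmul_eq_mul] at h1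
    have hd : (d : ℝ) ≠ 0 := by
      have := i.pos
      positivity
    exact mul_left_cancel₀ hd (by linarith)
  · exact hk.integral_coord_mul_coord_of_ne h

end IsRadialKernel

/-! ### Taylor remainders and second order consistency. -/

lemma abs_le_of_hasDerivAt_of_abs_le {f f' : ℝ → ℝ} {C : ℝ} (h0 : f 0 = 0)
    (hf : ∀ t ∈ Icc (0 : ℝ) 1, HasDerivAt f (f' t) t) (hf' : ∀ t ∈ Icc (0 : ℝ) 1, |f' t| ≤ C) :
    ∀ t ∈ Icc (0 : ℝ) 1, |f t| ≤ C := by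
  intro t ht
  have := (convex_Icc (0 : ℝ) 1).norm_image_sub_le_of_norm_hasDerivWithin_le
    (fun t ht => (hf t ht).hasDerivWithinAt) hf' (left_mem_Icc.2 zero_le_one) ht
  rw [h0, sub_zero, sub_zero, Real.norm_eq_abs, Real.norm_of_nonneg ht.1] at this
  have hC : 0 ≤ C := (abs_nonneg _).trans (hf' t ht)
  nlinarith [ht.2]

/-- Fourth order remainder of the symmetric second difference, in one variable. -/
lemma abs_second_difference_sub_le {ψ : ℕ → ℝ → ℝ} {C : ℝ}
    (hψ : ∀ n < 4, ∀ t ∈ Icc (-1 : ℝ) 1, HasDerivAt (ψ n) (ψ (n + 1) t) t)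
    (hC : ∀ t ∈ Icc (-1 : ℝ) 1, |ψ 4 t| ≤ C) :
    |ψ 0 1 + ψ 0 (-1) - 2 * ψ 0 0 - ψ 2 0| ≤ 2 * C := by
  have hp : ∀ n < 4, ∀ t ∈ Icc (0 : ℝ) 1, HasDerivAt (ψ n) (ψ (n + 1) t) t :=
    fun n hn t ht => hψ n hn t ⟨by linarith [ht.1], ht.2⟩
  have hm : ∀ n < 4, ∀ t ∈ Icc (0 : ℝ) 1,
      HasDerivAt (fun t => ψ n (-t)) (-ψ (n + 1) (-t)) t := fun n hn t ht => by
    exact ((hψ n hn (-t) ⟨by linarith [ht.2], by linarith [ht.1]⟩).scomp t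
      (hasDerivAt_neg t)).congr_deriv (by simp)
  have h4 : ∀ t ∈ Icc (0 : ℝ) 1, |ψ 4 t + ψ 4 (-t)| ≤ 2 * C := fun t ht => by
    have h1 := hC t ⟨by linarith [ht.1], ht.2⟩
    have h2 := hC (-t) ⟨by linarith [ht.2], by linarith [ht.1]⟩
    linarith [abs_add_le (ψ 4 t) (ψ 4 (-t))]
  -- Descent from order 4 to order 0: each function is the derivative of the next, all vanish at 0,
  -- and on `[0, 1]` the bound `2 * C` is inherited.
  have h3 := abs_le_of_hasDerivAt_of_abs_le (f := fun t => ψ 3 t - ψ 3 (-t)) (by simp)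
    (fun t ht => ((hp 3 (by norm_num) t ht).fun_sub (hm 3 (by norm_num) t ht)).congr_deriv
      (by simp)) h4
  have h2 := abs_le_of_hasDerivAt_of_abs_le (f := fun t => ψ 2 t + ψ 2 (-t) - 2 * ψ 2 0)
    (by simp; ring) (fun t ht => (((hp 2 (by norm_num) t ht).fun_add
      (hm 2 (by norm_num) t ht)).sub_const (2 * ψ 2 0)).congr_deriv (by simp [sub_eq_add_neg])) h3
  have h1 := abs_le_of_hasDerivAt_of_abs_le (f := fun t => ψ 1 t - ψ 1 (-t) - 2 * ψ 2 0 * t)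
    (by simp) (fun t ht => (((hp 1 (by norm_num) t ht).fun_sub (hm 1 (by norm_num) t ht)).fun_sub
        ((hasDerivAt_id t).const_mul (2 * ψ 2 0))).congr_deriv (by simp)) h2
  have h0 := abs_le_of_hasDerivAt_of_abs_le
    (f := fun t => ψ 0 t + ψ 0 (-t) - 2 * ψ 0 0 - ψ 2 0 * t ^ 2)
    (f' := fun t => ψ 1 t - ψ 1 (-t) - 2 * ψ 2 0 * t)
    (by simp; ring) (fun t ht => ((((hp 0 (by norm_num) t ht).fun_add
      (hm 0 (by norm_num) t ht)).sub_const (2 * ψ 0 0)).fun_sub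
        ((hasDerivAt_pow 2 t).const_mul (ψ 2 0))).congr_deriv (by push_cast; ring)) h1
  simpa using h0 1 (right_mem_Icc.2 zero_le_one)

lemma abs_second_difference_sub_iteratedFDeriv_le {U : Set (E d)} (hU : IsOpen U)
    {φ : E d → ℝ} (hφ : ContDiffOn ℝ 4 φ U) {M : ℝ}
    (hM : ∀ x ∈ U, ‖iteratedFDeriv ℝ 4 φ x‖ ≤ M) {x z : E d}
    (hxz : ∀ t ∈ Icc (-1 : ℝ) 1, x + t • z ∈ U) :
    |φ (x + z) + φ (x - z) - 2 * φ x - iteratedFDeriv ℝ 2 φ x (fun _ => z)| ≤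
      2 * (M * ‖z‖ ^ 4) := by
  have hmain := abs_second_difference_sub_le
    (ψ := fun n t => iteratedFDeriv ℝ n φ (x + t • z) fun _ => z) (C := M * ‖z‖ ^ 4)
    (fun n hn t ht => ?_) (fun t ht => ?_)
  · simpa [sub_eq_add_neg] using hmain
  · have hdiff : DifferentiableAt ℝ (iteratedFDeriv ℝ n φ) (x + t • z) :=
      (hφ.contDiffAt (hU.mem_nhds (hxz t ht))).differentiableAt_iteratedFDeriv
        (by exact_mod_cast hn)
    have hline : HasDerivAt (fun t : ℝ => x + t • z) z t := by
      simpa using ((hasDerivAt_id t).smul_const z).const_add x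
    have h1 := hdiff.hasFDerivAt.comp_hasDerivAt t hline
    have h2 := ((ContinuousMultilinearMap.apply ℝ (fun _ : Fin n => E d) ℝ
      (fun _ => z)).hasFDerivAt).comp_hasDerivAt t h1
    refine h2.congr_deriv ?_
    rw [iteratedFDeriv_succ_apply_left]
    rfl
  · refine ((iteratedFDeriv ℝ 4 φ (x + t • z)).le_opNorm _).trans ?_
    simp only [Finset.prod_const, Finset.card_univ, Fintype.card_fin]
    gcongr
    exact hM _ (hxz t ht)

lemma iteratedFDeriv_two_diag (φ : E d → ℝ) (x z : E d) :
    iteratedFDeriv ℝ 2 φ x (fun _ => z) =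
      ∑ i, ∑ j, z i * z j * iteratedFDeriv ℝ 2 φ x
        ![EuclideanSpace.basisFun (Fin d) ℝ i, EuclideanSpace.basisFun (Fin d) ℝ j] := by
  have hz : ∑ i, z i • EuclideanSpace.basisFun (Fin d) ℝ i = z := by
    simpa using (EuclideanSpace.basisFun (Fin d) ℝ).sum_repr z
  simp only [iteratedFDeriv_two_apply, Matrix.cons_val_zero, Matrix.cons_val_one]
  conv_lhs => rw [← hz]
  simp only [map_sum, map_smul, sum_apply, smul_apply, smul_eq_mul, Finset.mul_sum, mul_assoc]
  rw [Finset.sum_comm]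
  exact Finset.sum_congr rfl fun i _ => Finset.sum_congr rfl fun j _ => by ring

namespace IsRadialKernel

variable {δ G : ℝ} {k : E d → ℝ}

/-- The Hessian is integrated against the second moment matrix, which is the identity, so only its
trace remains. -/
lemma integral_iteratedFDeriv_two (hk : IsRadialKernel d δ G k) (φ : E d → ℝ) (x : E d) :
    Integrable (fun z => iteratedFDeriv ℝ 2 φ x (fun _ => z) * k z) ∧
      ∫ z, iteratedFDeriv ℝ 2 φ x (fun _ => z) * k z = Laplacian.laplacian φ x := by
  set c : Fin d → Fin d → ℝ := fun i j => iteratedFDeriv ℝ 2 φ x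
    ![EuclideanSpace.basisFun (Fin d) ℝ i, EuclideanSpace.basisFun (Fin d) ℝ j]
  have h1 : ∀ z : E d, iteratedFDeriv ℝ 2 φ x (fun _ => z) * k z =
      ∑ i, ∑ j, c i j * (z i * z j * k z) := by
    intro z
    rw [iteratedFDeriv_two_diag, Finset.sum_mul]
    refine Finset.sum_congr rfl fun i _ => ?_
    rw [Finset.sum_mul]
    exact Finset.sum_congr rfl fun j _ => by ring
  have hint : ∀ i j, Integrable fun z : E d => c i j * (z i * z j * k z) := fun i j =>
    (hk.integrable_coord_mul_coord i j).const_mul _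
  simp_rw [h1]
  refine ⟨integrable_finsetSum _ fun i _ => integrable_finsetSum _ fun j _ => hint i j, ?_⟩
  rw [integral_finsetSum _ fun i _ => integrable_finsetSum _ fun j _ => hint i j]
  simp_rw [integral_finsetSum _ fun j _ => hint _ j, integral_const_mul,
    hk.integral_coord_mul_coord]
  rw [InnerProductSpace.laplacian_eq_iteratedFDeriv_orthonormalBasis φ
    (EuclideanSpace.basisFun (Fin d) ℝ)]
  simp [c]

/-- Second order consistency of the nonlocal operator with the Laplacian. -/
lemma abs_two_mul_integral_sub_laplacian_le (hk : IsRadialKernel d δ G k) {U : Set (E d)}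
    (hU : IsOpen U) {φ : E d → ℝ} (hφ : ContDiffOn ℝ 4 φ U) {M : ℝ}
    (hM : ∀ x ∈ U, ‖iteratedFDeriv ℝ 4 φ x‖ ≤ M) {Φ : E d → ℝ} (hΦ : IsBM Φ) {x : E d}
    (hx : x ∈ U) (hxU : Metric.ball x δ ⊆ U) (hxΦ : EqOn Φ φ (Metric.ball x δ)) :
    |2 * (∫ z, (Φ (x + z) - Φ x) * k z) - Laplacian.laplacian φ x| ≤ 2 * M * d * δ ^ 2 := by
  obtain ⟨hint, hlap⟩ := hk.integral_iteratedFDeriv_two φ x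
  have hM0 : 0 ≤ M := (norm_nonneg _).trans (hM x hx)
  obtain ⟨hΦm, C, hC⟩ := hΦ
  have hi : ∀ s : E d → E d, Measurable s →
      Integrable fun z => (Φ (s z) - Φ x) * k z := fun s hs =>
    hk.integrable_bdd_mul ⟨(hΦm.comp hs).sub_const _, C + C, fun z =>
      (abs_sub _ _).trans (add_le_add (hC _) (hC _))⟩
  have hi1 := hi (fun z => x + z) (by fun_prop)
  have hi2 := hi (fun z => x - z) (by fun_prop)
  -- Averaging over `z` and `-z` turns the first difference into a symmetric second difference,
  -- removing the odd Taylor terms.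
  have hneg : ∫ z, (Φ (x - z) - Φ x) * k z = ∫ z, (Φ (x + z) - Φ x) * k z := by
    simpa [sub_eq_add_neg] using hk.integral_comp_neg fun z => Φ (x + z) - Φ x
  have heq : 2 * (∫ z, (Φ (x + z) - Φ x) * k z) - Laplacian.laplacian φ x =
      ∫ z, (Φ (x + z) - Φ x) * k z + (Φ (x - z) - Φ x) * k z
        - iteratedFDeriv ℝ 2 φ x (fun _ => z) * k z := by
    have hi3 : Integrable fun z => (Φ (x + z) - Φ x) * k z + (Φ (x - z) - Φ x) * k z :=
      hi1.add hi2
    rw [integral_sub hi3 hint, integral_add hi1 hi2, hneg, hlap]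
    ring
  have hmi : Integrable fun z => ‖z‖ ^ 2 * k z :=
    hk.integrable_mul_of_le (C := δ ^ 2) (by fun_prop) fun z hz => by
      rw [abs_of_nonneg (by positivity)]
      gcongr
  rw [heq]
  calc |∫ z, (Φ (x + z) - Φ x) * k z + (Φ (x - z) - Φ x) * k z
        - iteratedFDeriv ℝ 2 φ x (fun _ => z) * k z|
      ≤ ∫ z, 2 * M * δ ^ 2 * (‖z‖ ^ 2 * k z) := by
        rw [← Real.norm_eq_abs]
        refine norm_integral_le_of_norm_le (hmi.const_mul _) (ae_of_all _ fun z => ?_)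
        rw [← add_mul, ← sub_mul, norm_mul, Real.norm_of_nonneg (hk.nonneg z), ← mul_assoc]
        rcases lt_or_ge ‖z‖ δ with h | h
        · refine mul_le_mul_of_nonneg_right ?_ (hk.nonneg z)
          have hball : ∀ t ∈ Icc (-1 : ℝ) 1, x + t • z ∈ Metric.ball x δ := by
            intro t ht
            rw [mem_ball_iff_norm, add_sub_cancel_left, norm_smul]
            have : ‖t‖ ≤ 1 := abs_le.2 ht
            nlinarith [norm_nonneg z]
          have h1 := abs_second_difference_sub_iteratedFDeriv_le hU hφ hM (x := x) (z := z)
            fun t ht => hxU (hball t ht)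
          have e0 : Φ x = φ x := hxΦ (by simpa using hball 0 (by norm_num))
          have e1 : Φ (x + z) = φ (x + z) := hxΦ (by simpa using hball 1 (by norm_num))
          have e2 : Φ (x - z) = φ (x - z) :=
            hxΦ (by simpa [sub_eq_add_neg] using hball (-1) (by norm_num))
          rw [e0, e1, e2, Real.norm_eq_abs]
          calc |φ (x + z) - φ x + (φ (x - z) - φ x) - iteratedFDeriv ℝ 2 φ x fun _ => z|
              = |φ (x + z) + φ (x - z) - 2 * φ x - iteratedFDeriv ℝ 2 φ x fun _ => z| := by
                congr 1; ring
            _ ≤ 2 * (M * ‖z‖ ^ 4) := h1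
            _ = 2 * M * ‖z‖ ^ 2 * ‖z‖ ^ 2 := by ring
            -- Only two of the four powers of `‖z‖` are traded for `δ ^ 2`; the other two are
            -- absorbed by the normalized moment, so the total mass of the kernel does not enter.
            _ ≤ 2 * M * δ ^ 2 * ‖z‖ ^ 2 := by gcongr
        · simp [hk.eq_zero z h]
    _ = 2 * M * d * δ ^ 2 := by rw [integral_const_mul, hk.moment]; ring

end IsRadialKernel

end Kernel

/-! ### The nonlocal energy: basic bounds and the passage to `energyNorm`. -/

section Energy

variable {d : ℕ} {X : Type*} [MeasurableSpace X]

namespace IsBM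

lemma add {φ ψ : X → ℝ} (hφ : IsBM φ) (hψ : IsBM ψ) : IsBM fun x => φ x + ψ x := by
  obtain ⟨hφ, C, hC⟩ := hφ
  obtain ⟨hψ, D, hD⟩ := hψ
  exact ⟨hφ.add hψ, C + D, fun x => (abs_add_le _ _).trans (add_le_add (hC x) (hD x))⟩

lemma sub {φ ψ : X → ℝ} (hφ : IsBM φ) (hψ : IsBM ψ) : IsBM fun x => φ x - ψ x := by
  obtain ⟨hφ, C, hC⟩ := hφ
  obtain ⟨hψ, D, hD⟩ := hψ
  exact ⟨hφ.sub hψ, C + D, fun x => (abs_sub _ _).trans (add_le_add (hC x) (hD x))⟩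

lemma mul {φ ψ : X → ℝ} (hφ : IsBM φ) (hψ : IsBM ψ) : IsBM fun x => φ x * ψ x := by
  obtain ⟨hφ, C, hC⟩ := hφ
  obtain ⟨hψ, D, hD⟩ := hψ
  refine ⟨hφ.mul hψ, C * D, fun x => ?_⟩
  rw [abs_mul]
  exact mul_le_mul (hC x) (hD x) (abs_nonneg _) ((abs_nonneg _).trans (hC x))

lemma sq {φ : X → ℝ} (hφ : IsBM φ) : IsBM fun x => φ x ^ 2 := by
  simpa only [pow_two] using hφ.mul hφ

lemma comp {Y : Type*} [MeasurableSpace Y] {φ : X → ℝ} (hφ : IsBM φ) {s : Y → X}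
    (hs : Measurable s) : IsBM fun y => φ (s y) := by
  obtain ⟨hφ, C, hC⟩ := hφ
  exact ⟨hφ.comp hs, C, fun y => hC (s y)⟩

lemma indicator {φ : X → ℝ} (hφ : IsBM φ) {S : Set X} (hS : MeasurableSet S) :
    IsBM (S.indicator φ) := by
  obtain ⟨hφ, C, hC⟩ := hφ
  refine ⟨hφ.indicator hS, C, fun x => ?_⟩
  by_cases hx : x ∈ S
  · simp [hx, hC x]
  · simpa [hx] using (abs_nonneg _).trans (hC x)

lemma integrable {φ : X → ℝ} (hφ : IsBM φ) {ν : Measure X} [IsFiniteMeasure ν] :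
    Integrable φ ν := by
  obtain ⟨hφ, C, hC⟩ := hφ
  exact Integrable.of_bound hφ.aestronglyMeasurable C (ae_of_all _ hC)

lemma memLp_two {w : E d → ℝ} (hw : IsBM w) {Ω : Set (E d)} (hΩ : MeasurableSet Ω)
    (hΩv : volume Ω < ∞) (hw0 : ∀ x ∉ Ω, w x = 0) : MemLp w 2 volume := by
  have : IsFiniteMeasure (volume.restrict Ω) := ⟨by simpa using hΩv⟩
  have h : Ω.indicator w = w := indicator_eq_self.2 fun x hx => by
    by_contra h
    exact hx (hw0 x h)
  rw [← h, memLp_indicator_iff_restrict hΩ]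
  obtain ⟨hm, C, hC⟩ := hw
  exact MemLp.of_bound hm.aestronglyMeasurable C (ae_of_all _ hC)

end IsBM

/-- Lebesgue measure on `O × O`. -/
noncomputable abbrev pairMeasure (O : Set (E d)) : Measure (E d × E d) :=
  (volume.restrict O).prod (volume.restrict O)

/-- The square of the nonlocal energy norm. -/
noncomputable def energy (O : Set (E d)) (k : E d → ℝ) (φ : E d → ℝ) : ℝ :=
  ∫ p, (φ p.2 - φ p.1) ^ 2 * k (p.2 - p.1) ∂pairMeasure O

namespace IsRadialKernel

variable {δ G : ℝ} {k : E d → ℝ} {O : Set (E d)}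

lemma integrable_pair_kernel (hk : IsRadialKernel d δ G k) (hO : volume O < ∞) :
    Integrable (fun p : E d × E d => k (p.2 - p.1)) (pairMeasure O) := by
  have : IsFiniteMeasure (volume.restrict O) := ⟨by simpa using hO⟩
  have h : Integrable (fun p : E d × E d => k (p.2 - p.1)) ((volume.restrict O).prod volume) := by
    have hm : Measurable fun p : E d × E d => k (p.2 - p.1) :=
      hk.measurable.comp (measurable_snd.sub measurable_fst)
    rw [integrable_prod_iff hm.aestronglyMeasurable]
    refine ⟨ae_of_all _ fun x => hk.integrable.comp_sub_right x, ?_⟩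
    simp only [Real.norm_of_nonneg (hk.nonneg _)]
    simp_rw [integral_sub_right_eq_self k]
    exact integrable_const _
  have h2 : pairMeasure O = ((volume.restrict O).prod volume).restrict (univ ×ˢ O) := by
    rw [← Measure.prod_restrict, Measure.restrict_univ]
  rw [h2]
  exact h.restrict

lemma integrable_pair (hk : IsRadialKernel d δ G k) (hO : volume O < ∞) {Φ : E d × E d → ℝ}
    (hΦ : IsBM Φ) : Integrable (fun p : E d × E d => Φ p * k (p.2 - p.1)) (pairMeasure O) := by
  obtain ⟨hm, C, hC⟩ := hΦ
  exact (hk.integrable_pair_kernel hO).bdd_mul hm.aestronglyMeasurable (ae_of_all _ hC)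

lemma integrable_energy (hk : IsRadialKernel d δ G k) (hO : volume O < ∞) {φ : E d → ℝ}
    (hφ : IsBM φ) :
    Integrable (fun p : E d × E d => (φ p.2 - φ p.1) ^ 2 * k (p.2 - p.1)) (pairMeasure O) :=
  hk.integrable_pair hO ((hφ.comp measurable_snd).sub (hφ.comp measurable_fst)).sq

lemma energy_nonneg (hk : IsRadialKernel d δ G k) (φ : E d → ℝ) : 0 ≤ energy O k φ :=
  integral_nonneg fun _ => mul_nonneg (sq_nonneg _) (hk.nonneg _)

lemma integral_pair_swap (hk : IsRadialKernel d δ G k) (Φ : E d → E d → ℝ) :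
    ∫ p, Φ p.2 p.1 * k (p.2 - p.1) ∂pairMeasure O =
      ∫ p, Φ p.1 p.2 * k (p.2 - p.1) ∂pairMeasure O := by
  rw [← integral_prod_swap]
  refine integral_congr_ae (ae_of_all _ fun p => ?_)
  simp only [Prod.fst_swap, Prod.snd_swap]
  rw [← hk.map_neg, neg_sub]

/-- Expand by `(a - b)² ≤ 2a² + 2b²`, identify both terms by symmetry, and integrate out one
variable. No smoothness is needed, at the price of the factor `G = O(δ⁻²)`; this is the source of
`δ⁻¹ h²` in the final rate. -/
lemma energy_le_four_mul (hk : IsRadialKernel d δ G k) (hO : volume O < ∞) {φ : E d → ℝ}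
    (hφ : IsBM φ) : energy O k φ ≤ 4 * G * ∫ x in O, φ x ^ 2 := by
  have : IsFiniteMeasure (volume.restrict O) := ⟨by simpa using hO⟩
  have h1 := hk.integrable_pair hO (hφ.comp measurable_fst).sq
  have h2 := hk.integrable_pair hO (hφ.comp measurable_snd).sq
  have hsq : IsBM fun x => φ x ^ 2 := hφ.sq
  calc energy O k φ
      ≤ ∫ p, 2 * (φ p.2 ^ 2 * k (p.2 - p.1)) + 2 * (φ p.1 ^ 2 * k (p.2 - p.1)) ∂pairMeasure O := by
        refine integral_mono (hk.integrable_energy hO hφ)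
          ((h2.const_mul 2).add (h1.const_mul 2)) fun p => ?_
        have := hk.nonneg (p.2 - p.1)
        have h : (φ p.2 - φ p.1) ^ 2 ≤ 2 * φ p.2 ^ 2 + 2 * φ p.1 ^ 2 := by
          nlinarith [sq_nonneg (φ p.2 + φ p.1)]
        calc (φ p.2 - φ p.1) ^ 2 * k (p.2 - p.1)
            ≤ (2 * φ p.2 ^ 2 + 2 * φ p.1 ^ 2) * k (p.2 - p.1) := by gcongr
          _ = _ := by ring
    _ = 4 * ∫ p, φ p.1 ^ 2 * k (p.2 - p.1) ∂pairMeasure O := by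
        rw [integral_add (h2.const_mul 2) (h1.const_mul 2), integral_const_mul,
          integral_const_mul, hk.integral_pair_swap fun x _ => φ x ^ 2]
        ring
    _ = 4 * ∫ x in O, φ x ^ 2 * ∫ y in O, k (y - x) := by
        rw [integral_prod _ h1]
        simp_rw [integral_const_mul]
    _ ≤ 4 * ∫ x in O, φ x ^ 2 * G := by
        refine mul_le_mul_of_nonneg_left ?_ (by norm_num)
        refine integral_mono ?_ (hsq.integrable.mul_const G) fun x => ?_
        · simpa only [integral_const_mul] using h1.integral_prod_left
        · refine mul_le_mul_of_nonneg_left ?_ (sq_nonneg _)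
          calc ∫ y in O, k (y - x) ≤ ∫ y, k (y - x) :=
                setIntegral_le_integral (hk.integrable.comp_sub_right x)
                  (ae_of_all _ fun y => hk.nonneg _)
            _ ≤ G := by rw [integral_sub_right_eq_self k]; exact hk.mass_le
    _ = 4 * G * ∫ x in O, φ x ^ 2 := by rw [integral_mul_const]; ring

end IsRadialKernel

lemma setIntegral_sq_le {O A : Set (E d)} (hA : MeasurableSet A) (hAO : A ⊆ O) {φ : E d → ℝ}
    {c a : ℝ} (ha0 : 0 ≤ a) (ha : volume A ≤ ENNReal.ofReal a) (hφ : ∀ x ∈ A, |φ x| ≤ c)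
    (hφ0 : ∀ x ∉ A, φ x = 0) : ∫ x in O, φ x ^ 2 ≤ c ^ 2 * a := by
  have h1 : (fun x => φ x ^ 2) = A.indicator fun x => φ x ^ 2 := by
    refine (indicator_eq_self.2 fun x hx => ?_).symm
    by_contra h
    exact hx (by simp [hφ0 x h])
  rw [h1, setIntegral_indicator hA, inter_eq_right.2 hAO]
  have hlt : volume A < ∞ := ha.trans_lt ENNReal.ofReal_lt_top
  calc ∫ x in A, φ x ^ 2 ≤ ‖∫ x in A, φ x ^ 2‖ := le_abs_self _
    _ ≤ c ^ 2 * volume.real A := by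
        refine norm_setIntegral_le_of_norm_le_const hlt fun x hx => ?_
        rw [Real.norm_of_nonneg (sq_nonneg _)]
        exact sq_le_sq' (abs_le.1 (hφ x hx)).1 (abs_le.1 (hφ x hx)).2
    _ ≤ c ^ 2 * a := by
        gcongr
        exact ENNReal.toReal_le_of_le_ofReal ha0 ha

lemma energyNorm_eq {Ω : Set (E d)} (hΩ : IsOpen Ω) {δ G : ℝ} (hδ : 0 < δ) {γ : ℝ → ℝ}
    (hk : IsRadialKernel d δ G (cutKernel d δ γ)) (hγ : ∀ s, δ < s → γ s = 0)
    (hO : volume (enlargedDomain Ω δ) < ∞) {u φ : E d → ℝ} (hφ : IsBM φ)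
    (hu : EqOn u φ (enlargedDomain Ω δ)) :
    energyNorm Ω δ γ u =
      ENNReal.ofReal (√(energy (enlargedDomain Ω δ) (cutKernel d δ γ) φ)) := by
  have hOm := measurableSet_enlargedDomain hΩ δ
  have h1 := hk.integrable_energy hO hφ
  have h2 : (∫⁻ x in enlargedDomain Ω δ, ∫⁻ y in enlargedDomain Ω δ,
      ENNReal.ofReal ((u y - u x) ^ 2 * γ ‖y - x‖)) =
      ENNReal.ofReal (energy (enlargedDomain Ω δ) (cutKernel d δ γ) φ) := by
    rw [energy, ofReal_integral_eq_lintegral_ofReal h1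
      (ae_of_all _ fun p => mul_nonneg (sq_nonneg _) (hk.nonneg _)),
      lintegral_prod _ h1.aestronglyMeasurable.aemeasurable.ennreal_ofReal]
    refine setLIntegral_congr_fun hOm fun x hx => lintegral_congr_ae ?_
    -- The profile may be nonzero at `δ` itself, where `cutKernel` vanishes; spheres are null sets,
    -- so the integrals agree.
    have hsph : ∀ᵐ y ∂volume.restrict (enlargedDomain Ω δ), y ∉ Metric.sphere x δ :=
      ae_restrict_of_ae (measure_eq_zero_iff_ae_notMem.1
        (Measure.addHaar_sphere_of_ne_zero volume x hδ.ne'))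
    filter_upwards [hsph, ae_restrict_mem hOm] with y hy hyO
    rw [hu hx, hu hyO]
    rw [mem_sphere_iff_norm] at hy
    rcases lt_or_gt_of_ne hy with h | h
    · rw [cutKernel_of_lt h]
    · rw [cutKernel_of_le h.le, hγ _ h]
  rw [energyNorm, h2, ENNReal.ofReal_rpow_of_nonneg (hk.energy_nonneg φ) (by norm_num),
    Real.sqrt_eq_rpow]

/-! ### Nonlocal Poincaré inequality by repeated translation. -/

section Poincare

variable {Ω : Set (E d)} {w : E d → ℝ}

lemma integrable_sq_translate_sub (hw : MemLp w 2 volume) (a b : E d) :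
    Integrable fun x => (w (x + a) - w (x + b)) ^ 2 :=
  ((hw.comp_measurePreserving (measurePreserving_add_right volume a)).sub
    (hw.comp_measurePreserving (measurePreserving_add_right volume b))).integrable_sq

/-- Comparison of the differences along `n • z` and along `z`. -/
lemma integral_sq_translate_nsmul_le (hw : MemLp w 2 volume) (n : ℕ) (z : E d) :
    ∫ x, (w (x + n • z) - w x) ^ 2 ≤ n ^ 2 * ∫ x, (w (x + z) - w x) ^ 2 := by
  have hstep : ∀ j : ℕ, ∫ x, (w (x + (j + 1) • z) - w (x + j • z)) ^ 2 =
      ∫ x, (w (x + z) - w x) ^ 2 := by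
    intro j
    rw [← integral_add_right_eq_self (fun x => (w (x + z) - w x) ^ 2) (j • z)]
    simp only [add_smul, one_smul, add_assoc]
  have hint : ∀ j : ℕ, Integrable fun x => (w (x + (j + 1) • z) - w (x + j • z)) ^ 2 :=
    fun j => integrable_sq_translate_sub hw _ _
  calc ∫ x, (w (x + n • z) - w x) ^ 2
      ≤ ∫ x, n * ∑ j ∈ Finset.range n, (w (x + (j + 1) • z) - w (x + j • z)) ^ 2 := by
        refine integral_mono (by simpa using integrable_sq_translate_sub hw (n • z) 0)
          ((integrable_finsetSum _ fun j _ => hint j).const_mul _) fun x => ?_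
        have h := Finset.sum_range_sub (fun j : ℕ => w (x + j • z)) n
        simp only [zero_smul, add_zero] at h
        rw [← h]
        simpa using sq_sum_le_card_mul_sum_sq (s := Finset.range n)
          (f := fun j => w (x + (j + 1) • z) - w (x + j • z))
    _ = n ^ 2 * ∫ x, (w (x + z) - w x) ^ 2 := by
        rw [integral_const_mul, integral_finsetSum _ fun j _ => hint j]
        simp only [hstep, Finset.sum_const, Finset.card_range, nsmul_eq_mul]
        ring

/-- If `w` vanishes outside a set of diameter at most `R`, then `w` and its translate by a vector
longer than `R` have disjoint supports. -/
lemma integral_sq_translate_of_lt (hw : MemLp w 2 volume) (hw0 : ∀ x ∉ Ω, w x = 0) {R : ℝ}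
    (hR : ∀ x ∈ Ω, ∀ y ∈ Ω, ‖y - x‖ ≤ R) {a : E d} (ha : R < ‖a‖) :
    ∫ x, (w (x + a) - w x) ^ 2 = 2 * ∫ x, w x ^ 2 := by
  have h1 : ∀ x, (w (x + a) - w x) ^ 2 = w (x + a) ^ 2 + w x ^ 2 := by
    intro x
    have : w (x + a) * w x = 0 := by
      by_contra h
      have hx : x ∈ Ω := by_contra fun hx => h (by simp [hw0 x hx])
      have hxa : x + a ∈ Ω := by_contra fun hx => h (by simp [hw0 _ hx])
      have := hR x hx _ hxa
      rw [add_sub_cancel_left] at this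
      linarith
    linear_combination (-2) * this
  simp_rw [h1]
  have hwa : Integrable fun x => w (x + a) ^ 2 :=
    (hw.comp_measurePreserving (measurePreserving_add_right volume a)).integrable_sq
  rw [integral_add hwa hw.integrable_sq,
    integral_add_right_eq_self (fun x => w x ^ 2) a]
  ring

lemma sq_norm_mul_integral_sq_le (hw : MemLp w 2 volume) (hw0 : ∀ x ∉ Ω, w x = 0) {R δ : ℝ}
    (hR0 : 0 ≤ R) (hR : ∀ x ∈ Ω, ∀ y ∈ Ω, ‖y - x‖ ≤ R) {z : E d} (hz : ‖z‖ ≤ δ) :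
    2 * ‖z‖ ^ 2 * ∫ x, w x ^ 2 ≤ (R + δ) ^ 2 * ∫ x, (w (x + z) - w x) ^ 2 := by
  have hnn : 0 ≤ ∫ x, (w (x + z) - w x) ^ 2 := integral_nonneg fun x => sq_nonneg _
  rcases eq_or_ne z 0 with rfl | hz0
  · simp
  have hzp : 0 < ‖z‖ := norm_pos_iff.2 hz0
  -- Just enough steps for `n • z` to be longer than the diameter bound `R`, while `n * ‖z‖ ≤ R +
  -- δ`. The translated supports are then disjoint, and the loss `n ^ 2` is compensated by `‖z‖ ^
  -- 2`.
  set n := ⌊R / ‖z‖⌋₊ + 1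
  have hn1 : R < n * ‖z‖ := by
    rw [← div_lt_iff₀ hzp]
    exact_mod_cast Nat.lt_floor_add_one (R / ‖z‖)
  have hn2 : n * ‖z‖ ≤ R + δ := by
    have : (n : ℝ) ≤ R / ‖z‖ + 1 := by
      have := Nat.floor_le (div_nonneg hR0 hzp.le)
      simp only [n, Nat.cast_add, Nat.cast_one]
      linarith
    calc n * ‖z‖ ≤ (R / ‖z‖ + 1) * ‖z‖ := by gcongr
      _ = R + ‖z‖ := by field_simp
      _ ≤ R + δ := by linarith
  have hnz : ‖n • z‖ = n * ‖z‖ := by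
    rw [← Nat.cast_smul_eq_nsmul ℝ, norm_smul, Real.norm_natCast]
  have h := integral_sq_translate_nsmul_le hw n z
  rw [integral_sq_translate_of_lt hw hw0 hR (by rw [hnz]; exact hn1)] at h
  calc 2 * ‖z‖ ^ 2 * ∫ x, w x ^ 2 = ‖z‖ ^ 2 * (2 * ∫ x, w x ^ 2) := by ring
    _ ≤ ‖z‖ ^ 2 * (n ^ 2 * ∫ x, (w (x + z) - w x) ^ 2) := by gcongr
    _ = (n * ‖z‖) ^ 2 * ∫ x, (w (x + z) - w x) ^ 2 := by ring
    _ ≤ _ := by gcongr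

/-- Nonlocal Poincaré inequality, with a constant that does not depend on the kernel. -/
lemma IsRadialKernel.poincare {δ G : ℝ} {k : E d → ℝ} (hk : IsRadialKernel d δ G k)
    {O : Set (E d)} (hO : volume O < ∞) (hΩm : MeasurableSet Ω)
    (hΩO : Ω ⊆ O) (hball : ∀ x ∈ Ω, Metric.ball x δ ⊆ O) (hw : IsBM w) (hw0 : ∀ x ∉ Ω, w x = 0)
    {R : ℝ} (hR0 : 0 ≤ R) (hR : ∀ x ∈ Ω, ∀ y ∈ Ω, ‖y - x‖ ≤ R) :
    2 * d * ∫ x in Ω, w x ^ 2 ≤ (R + δ) ^ 2 * energy O k w := by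
  have hwL : MemLp w 2 volume := hw.memLp_two hΩm ((measure_mono hΩO).trans_lt hO) hw0
  set F : E d × E d → ℝ := fun p => (w p.2 - w p.1) ^ 2 * k (p.2 - p.1)
  -- A contributing pair has a point in `Ω` and distance less than `δ`, so both points lie in `O`.
  -- The energy is thus an integral over the whole space, where translation invariance is available.
  have hF0 : ∀ p ∉ O ×ˢ O, F p = 0 := by
    rintro ⟨x, y⟩ hp
    simp only [F]
    rcases lt_or_ge ‖y - x‖ δ with h | h
    · have hx : x ∉ Ω := fun hx => hp ⟨hΩO hx, hball x hx (mem_ball_iff_norm.2 h)⟩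
      have hy : y ∉ Ω := fun hy => hp ⟨hball y hy (mem_ball_iff_norm'.2 h), hΩO hy⟩
      simp [hw0 x hx, hw0 y hy]
    · simp [hk.eq_zero _ h]
  have hpm : pairMeasure O = (volume : Measure (E d × E d)).restrict (O ×ˢ O) :=
    Measure.prod_restrict O O
  have hen : energy O k w = ∫ p, F p := by
    rw [energy, hpm]
    exact setIntegral_eq_integral_of_forall_compl_eq_zero hF0
  have hFi : Integrable F := by
    have := hk.integrable_energy hO hw
    rw [hpm] at this
    exact (integrableOn_iff_integrable_of_support_subset fun p hp => by
      by_contra h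
      exact hp (hF0 p h)).1 this
  -- The shear from `(x, z)` to `(x, x + z)` rewrites the energy as an average over `z` of
  -- translation differences. The estimate for each `z` is then integrated against `k`, and the
  -- normalized moment yields `d`.
  have hmp := measurePreserving_prod_add (volume : Measure (E d)) (volume : Measure (E d))
  have hGi : Integrable (fun p : E d × E d => (w (p.1 + p.2) - w p.1) ^ 2 * k p.2)
      (volume.prod volume) := by
    have := hmp.integrable_comp_of_integrable hFi
    simpa [F, Function.comp_def] using this
  have hG : ∫ p, F p = ∫ z, (∫ x, (w (x + z) - w x) ^ 2) * k z := by
    have h := hmp.integral_comp (MeasurableEquiv.shearAddRight (E d)).measurableEmbedding F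
    calc ∫ p, F p = ∫ p : E d × E d, (w (p.1 + p.2) - w p.1) ^ 2 * k p.2 ∂volume.prod volume := by
          rw [Measure.volume_eq_prod, ← h]
          simp [F]
      _ = _ := by
          rw [integral_prod_symm _ hGi]
          simp_rw [integral_mul_const]
  have hmi : Integrable fun z => ‖z‖ ^ 2 * k z :=
    hk.integrable_mul_of_le (C := δ ^ 2) (by fun_prop) fun z hz => by
      rw [abs_of_nonneg (by positivity)]
      gcongr
  have hws : ∫ x in Ω, w x ^ 2 = ∫ x, w x ^ 2 :=
    setIntegral_eq_integral_of_forall_compl_eq_zero fun x hx => by simp [hw0 x hx]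
  rw [hws, hen, hG]
  calc 2 * d * ∫ x, w x ^ 2 = ∫ z, (2 * ∫ x, w x ^ 2) * (‖z‖ ^ 2 * k z) := by
        rw [integral_const_mul, hk.moment]; ring
    _ ≤ ∫ z, (R + δ) ^ 2 * ((∫ x, (w (x + z) - w x) ^ 2) * k z) := by
        refine integral_mono (hmi.const_mul _) (Integrable.const_mul ?_ _) fun z => ?_
        · simpa only [integral_mul_const] using hGi.integral_prod_right
        · rcases lt_or_ge ‖z‖ δ with h | h
          · have h1 := mul_le_mul_of_nonneg_right
              (sq_norm_mul_integral_sq_le hwL hw0 hR0 hR h.le) (hk.nonneg z)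
            calc _ = 2 * ‖z‖ ^ 2 * (∫ x, w x ^ 2) * k z := by ring
              _ ≤ _ := h1
              _ = _ := by ring
          · simp [hk.eq_zero z h]
    _ = _ := integral_const_mul _ _

end Poincare

end Energy

/-! ### Variational identities: integration by parts, Galerkin equations, abstract error bound. -/

section Variational

variable {d : ℕ}

/-- The bilinear form of the nonlocal energy. -/
noncomputable def energyForm (O : Set (E d)) (k : E d → ℝ) (φ ψ : E d → ℝ) : ℝ :=
  ∫ p, (φ p.2 - φ p.1) * (ψ p.2 - ψ p.1) * k (p.2 - p.1) ∂pairMeasure O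

namespace IsRadialKernel

variable {δ G : ℝ} {k : E d → ℝ} {O Ω : Set (E d)} {φ ψ : E d → ℝ}

lemma integrable_energyForm (hk : IsRadialKernel d δ G k) (hO : volume O < ∞) (hφ : IsBM φ)
    (hψ : IsBM ψ) : Integrable (fun p : E d × E d =>
      (φ p.2 - φ p.1) * (ψ p.2 - ψ p.1) * k (p.2 - p.1)) (pairMeasure O) :=
  hk.integrable_pair hO (((hφ.comp measurable_snd).sub (hφ.comp measurable_fst)).mul
    ((hψ.comp measurable_snd).sub (hψ.comp measurable_fst)))

lemma energy_eq_energyForm_add (hk : IsRadialKernel d δ G k) (hO : volume O < ∞)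
    {e w η : E d → ℝ} (he : IsBM e) (hw : IsBM w) (hη : IsBM η) (h : ∀ x, e x = w x + η x) :
    energy O k e = energyForm O k e w + energyForm O k e η := by
  rw [energy, energyForm, energyForm, ← integral_add (hk.integrable_energyForm hO he hw)
    (hk.integrable_energyForm hO he hη)]
  refine integral_congr_ae (ae_of_all _ fun p => ?_)
  have h1 := h p.1
  have h2 := h p.2
  linear_combination (e p.2 - e p.1) * k (p.2 - p.1) * (h2 - h1)

lemma energyForm_sub_left (hk : IsRadialKernel d δ G k) (hO : volume O < ∞)
    {w : E d → ℝ} (hφ : IsBM φ) (hψ : IsBM ψ) (hw : IsBM w) :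
    energyForm O k (fun x => φ x - ψ x) w = energyForm O k φ w - energyForm O k ψ w := by
  rw [energyForm, energyForm, energyForm, ← integral_sub (hk.integrable_energyForm hO hφ hw)
    (hk.integrable_energyForm hO hψ hw)]
  exact integral_congr_ae (ae_of_all _ fun p => by ring)

lemma energyForm_le (hk : IsRadialKernel d δ G k) (hO : volume O < ∞) (hφ : IsBM φ)
    (hψ : IsBM ψ) : energyForm O k φ ψ ≤ energy O k φ / 4 + energy O k ψ := by
  have h1 := hk.integrable_energy hO hφ
  have h2 := hk.integrable_energy hO hψ
  rw [energyForm, energy, energy, div_eq_inv_mul, ← integral_const_mul,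
    ← integral_add (h1.const_mul _) h2]
  refine integral_mono (hk.integrable_energyForm hO hφ hψ) ((h1.const_mul _).add h2) fun p => ?_
  have := hk.nonneg (p.2 - p.1)
  set a := φ p.2 - φ p.1
  set b := ψ p.2 - ψ p.1
  have h : a * b ≤ 4⁻¹ * a ^ 2 + b ^ 2 := by nlinarith [sq_nonneg (a / 2 - b)]
  calc a * b * k (p.2 - p.1) ≤ (4⁻¹ * a ^ 2 + b ^ 2) * k (p.2 - p.1) := by gcongr
    _ = _ := by simp only [a, b]; ring

lemma energy_le_of_sq_le (hk : IsRadialKernel d δ G k) (hO : volume O < ∞) (hφ : IsBM φ)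
    (hψ : IsBM ψ) {w : E d → ℝ} (hw : IsBM w)
    (h : ∀ x y, (w y - w x) ^ 2 ≤ 2 * (φ y - φ x) ^ 2 + 2 * (ψ y - ψ x) ^ 2) :
    energy O k w ≤ 2 * energy O k φ + 2 * energy O k ψ := by
  have h1 := hk.integrable_energy hO hφ
  have h2 := hk.integrable_energy hO hψ
  rw [energy, energy, energy, ← integral_const_mul, ← integral_const_mul,
    ← integral_add (h1.const_mul _) (h2.const_mul _)]
  refine integral_mono (hk.integrable_energy hO hw) ((h1.const_mul _).add (h2.const_mul _))
    fun p => ?_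
  have := hk.nonneg (p.2 - p.1)
  calc (w p.2 - w p.1) ^ 2 * k (p.2 - p.1)
      ≤ (2 * (φ p.2 - φ p.1) ^ 2 + 2 * (ψ p.2 - ψ p.1) ^ 2) * k (p.2 - p.1) := by
        gcongr
        exact h _ _
    _ = _ := by ring

lemma energy_add_le (hk : IsRadialKernel d δ G k) (hO : volume O < ∞) (hφ : IsBM φ)
    (hψ : IsBM ψ) :
    energy O k (fun x => φ x + ψ x) ≤ 2 * energy O k φ + 2 * energy O k ψ :=
  hk.energy_le_of_sq_le hO hφ hψ (hφ.add hψ) fun x y => by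
    nlinarith [sq_nonneg (φ y - φ x - (ψ y - ψ x))]

lemma energy_sub_le (hk : IsRadialKernel d δ G k) (hO : volume O < ∞) (hφ : IsBM φ)
    (hψ : IsBM ψ) :
    energy O k (fun x => φ x - ψ x) ≤ 2 * energy O k φ + 2 * energy O k ψ :=
  hk.energy_le_of_sq_le hO hφ hψ (hφ.sub hψ) fun x y => by
    nlinarith [sq_nonneg (φ y - φ x + (ψ y - ψ x))]

lemma integrable_mul_operator (hk : IsRadialKernel d δ G k) (hO : volume O < ∞)
    {w : E d → ℝ} (hw : IsBM w) {Φ : E d × E d → ℝ} (hΦ : IsBM Φ) :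
    IntegrableOn (fun x => w x * ∫ y in O, Φ (x, y) * k (y - x)) O := by
  have h := (hk.integrable_pair hO ((hw.comp measurable_fst).mul hΦ)).integral_prod_left
  simp only [mul_assoc, integral_const_mul] at h
  exact h

/-- Nonlocal integration by parts. -/
lemma energyForm_eq (hk : IsRadialKernel d δ G k) (hO : volume O < ∞)
    {w : E d → ℝ} (hφ : IsBM φ) (hw : IsBM w) :
    energyForm O k φ w = -2 * ∫ x in O, w x * ∫ y in O, (φ y - φ x) * k (y - x) := by
  have hd : IsBM fun p : E d × E d => φ p.2 - φ p.1 :=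
    (hφ.comp measurable_snd).sub (hφ.comp measurable_fst)
  have h1 := hk.integrable_pair hO ((hw.comp measurable_fst).mul hd)
  have h2 := hk.integrable_pair hO ((hw.comp measurable_snd).mul hd)
  have h3 : ∫ p, w p.2 * (φ p.2 - φ p.1) * k (p.2 - p.1) ∂pairMeasure O =
      -∫ p, w p.1 * (φ p.2 - φ p.1) * k (p.2 - p.1) ∂pairMeasure O := by
    rw [hk.integral_pair_swap fun x y => w x * (φ x - φ y), ← integral_neg]
    exact integral_congr_ae (ae_of_all _ fun p => by ring)
  have h4 : energyForm O k φ w =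
      ∫ p, (w p.2 * (φ p.2 - φ p.1) * k (p.2 - p.1)
        - w p.1 * (φ p.2 - φ p.1) * k (p.2 - p.1)) ∂pairMeasure O :=
    integral_congr_ae (ae_of_all _ fun p => by ring)
  rw [h4, integral_sub h2 h1, h3, integral_prod _ h1]
  simp only [mul_assoc, integral_const_mul]
  ring

/-- The error of a Galerkin solution is almost orthogonal to a test function, up to the
truncation error `T`. -/
lemma energyForm_error_le (hk : IsRadialKernel d δ G k) (hOm : MeasurableSet O)
    (hO : volume O < ∞) (hΩm : MeasurableSet Ω) (hΩO : Ω ⊆ O) {Φ u w f : E d → ℝ} (hΦ : IsBM Φ) (hu : IsBM u)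
    (hw : IsBM w) (hw0 : ∀ x ∉ Ω, w x = 0) (hf : AEStronglyMeasurable f (volume.restrict Ω))
    {T : ℝ} (hT : ∀ x ∈ Ω, |2 * (∫ y in O, (Φ y - Φ x) * k (y - x)) + f x| ≤ T)
    (hgal : energyForm O k u w = ∫ x in Ω, f x * w x) :
    energyForm O k (fun x => Φ x - u x) w ≤ T * ∫ x in Ω, |w x| := by
  have : IsFiniteMeasure (volume.restrict Ω) :=
    ⟨by simpa using (measure_mono hΩO).trans_lt hO⟩
  set J : E d → ℝ := fun x => ∫ y in O, (Φ y - Φ x) * k (y - x)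
  have hJi : IntegrableOn (fun x => w x * J x) Ω :=
    (hk.integrable_mul_operator hO hw
      ((hΦ.comp measurable_snd).sub (hΦ.comp measurable_fst))).mono_set hΩO
  have hwi : IntegrableOn w Ω := hw.integrable
  -- `f` is not assumed bounded; integrability of `f * w` comes from the bound `T` on the truncation
  -- error and the integrability of `w * J`.
  have hfw : IntegrableOn (fun x => f x * w x) Ω := by
    refine ((hwi.norm.const_mul T).add (hJi.norm.const_mul 2)).mono'
      (hf.mul hw.1.aestronglyMeasurable) ?_
    filter_upwards [ae_restrict_mem hΩm] with x hx
    have h1 : f x * w x = w x * (2 * J x + f x) - 2 * (w x * J x) := by ring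
    calc ‖f x * w x‖ ≤ ‖w x * (2 * J x + f x)‖ + ‖2 * (w x * J x)‖ := by
          rw [h1]; exact norm_sub_le _ _
      _ ≤ T * ‖w x‖ + 2 * ‖w x * J x‖ := by
          rw [norm_mul, norm_mul 2, mul_comm T]
          gcongr
          · exact hT x hx
          · norm_num
  have hΩ : ∫ x in O, w x * J x = ∫ x in Ω, w x * J x := by
    refine setIntegral_eq_of_subset_of_forall_sdiff_eq_zero hOm hΩO fun x hx => ?_
    rw [hw0 x hx.2, zero_mul]
  rw [hk.energyForm_sub_left hO hΦ hu hw, hgal, hk.energyForm_eq hO hΦ hw, hΩ,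
    ← integral_const_mul, ← integral_const_mul, ← integral_sub (hJi.const_mul _) hfw]
  refine setIntegral_mono_on ((hJi.const_mul _).sub hfw) (hwi.norm.const_mul _) hΩm
    fun x hx => ?_
  calc -2 * (w x * J x) - f x * w x = -(w x * (2 * J x + f x)) := by ring
    _ ≤ |w x * (2 * J x + f x)| := neg_le_abs _
    _ ≤ T * |w x| := by
        rw [abs_mul, mul_comm]
        exact mul_le_mul_of_nonneg_right (hT x hx) (abs_nonneg _)

/-- Energy estimate for a splitting `e = w + η` of the error in a test function and a remainder. -/
lemma energy_error_le (hk : IsRadialKernel d δ G k) (hO : volume O < ∞)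
    (hΩO : Ω ⊆ O) {e w η : E d → ℝ} (he : IsBM e) (hw : IsBM w) (hη : IsBM η)
    (hsplit : ∀ x, e x = w x + η x) {T c : ℝ} (hc : 0 < c)
    (hP : ∫ x in Ω, w x ^ 2 ≤ c * energy O k w)
    (hB : energyForm O k e w ≤ T * ∫ x in Ω, |w x|) :
    energy O k e ≤ 5 / 2 * energy O k η + 4 * c * T ^ 2 * volume.real Ω := by
  have : IsFiniteMeasure (volume.restrict Ω) :=
    ⟨by simpa using (measure_mono hΩO).trans_lt hO⟩
  have h1 := hk.energy_eq_energyForm_add hO he hw hη hsplit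
  have h2 := hk.energyForm_le hO he hη
  have h3 : energy O k w ≤ 2 * energy O k e + 2 * energy O k η := by
    have hwe : w = fun x => e x - η x := funext fun x => by rw [hsplit x]; ring
    rw [hwe]
    exact hk.energy_sub_le hO he hη
  have hwi : IntegrableOn w Ω := hw.integrable
  have hw2 : IntegrableOn (fun x => w x ^ 2) Ω := hw.sq.integrable
  have h4 : T * ∫ x in Ω, |w x| ≤
      (8 * c)⁻¹ * (∫ x in Ω, w x ^ 2) + 2 * c * T ^ 2 * volume.real Ω := by
    have hrhs : (8 * c)⁻¹ * (∫ x in Ω, w x ^ 2) + 2 * c * T ^ 2 * volume.real Ω =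
        ∫ x in Ω, ((8 * c)⁻¹ * w x ^ 2 + 2 * c * T ^ 2) := by
      rw [integral_add (hw2.const_mul _) (integrable_const _), integral_const_mul,
        setIntegral_const, smul_eq_mul]
      ring
    rw [hrhs, ← integral_const_mul]
    refine integral_mono (hwi.norm.const_mul _)
      ((hw2.const_mul _).add (integrable_const _)) fun x => ?_
    -- Young's inequality by completing the square. The weight `8 * c` makes the Poincaré term an
    -- eighth of the energy of `w`, hence a quarter of that of `e` plus a quarter of that of `η`.
    -- With the other quarter from `energyForm_le`, half the energy of `e` is absorbed.
    have h5 : (8 * c)⁻¹ * w x ^ 2 + 2 * c * T ^ 2 - T * |w x| =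
        (8 * c)⁻¹ * (|w x| - 4 * c * T) ^ 2 := by
      rw [← sq_abs (w x)]
      field_simp
      ring
    have h6 : 0 ≤ (8 * c)⁻¹ * (|w x| - 4 * c * T) ^ 2 := by positivity
    show T * |w x| ≤ (8 * c)⁻¹ * w x ^ 2 + 2 * c * T ^ 2
    linarith
  have h7 : (8 * c)⁻¹ * (∫ x in Ω, w x ^ 2) ≤ energy O k w / 8 := by
    calc (8 * c)⁻¹ * (∫ x in Ω, w x ^ 2) ≤ (8 * c)⁻¹ * (c * energy O k w) := by gcongr
      _ = energy O k w / 8 := by field_simp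
  linarith

end IsRadialKernel

lemma setIntegral_ball_inter_eq {δ : ℝ} {γ : ℝ → ℝ} {O S : Set (E d)} (hO : MeasurableSet O)
    (hS : MeasurableSet S) (hSO : S ⊆ O) (x : E d) (ψ : E d → ℝ) :
    ∫ y in Metric.ball x δ ∩ S, ψ y * γ ‖y - x‖ =
      ∫ y in O, S.indicator ψ y * cutKernel d δ γ (y - x) := by
  rw [← integral_indicator (measurableSet_ball.inter hS), ← integral_indicator hO]
  congr 1 with y
  by_cases hy : y ∈ S
  · by_cases h : ‖y - x‖ < δ
    · simp [hy, hSO hy, h, cutKernel_of_lt, dist_eq_norm]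
    · simp [h, hSO hy, cutKernel_of_le (not_lt.1 h), dist_eq_norm]
  · simp [hy, indicator]

/-- The Galerkin equations in terms of the energy form. -/
lemma energyForm_galerkin {Ω : Set (E d)} (hΩ : IsOpen Ω) {δ G : ℝ} {γ : ℝ → ℝ}
    (hk : IsRadialKernel d δ G (cutKernel d δ γ)) (hO : volume (enlargedDomain Ω δ) < ∞)
    {u₀ g w f : E d → ℝ} (hu : IsBM u₀) (hu0 : ∀ x ∉ Ω, u₀ x = 0) (hg : IsBM g)
    (hg0 : ∀ x ∉ interactionDomain Ω δ, g x = 0) (hw : IsBM w) (hw0 : ∀ x ∉ Ω, w x = 0)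
    (h : -2 * (∫ x in Ω, w x * ∫ y in Metric.ball x δ ∩ Ω, (u₀ y - u₀ x) * γ ‖y - x‖) =
        (∫ x in Ω, f x * w x) +
          2 * ∫ x in Ω, w x *
            ∫ y in Metric.ball x δ ∩ interactionDomain Ω δ, (g y - u₀ x) * γ ‖y - x‖) :
    energyForm (enlargedDomain Ω δ) (cutKernel d δ γ) (fun x => u₀ x + g x) w =
      ∫ x in Ω, f x * w x := by
  set O := enlargedDomain Ω δ
  set I := interactionDomain Ω δ
  set k : E d → ℝ := cutKernel d δ γ
  have hOm : MeasurableSet O := measurableSet_enlargedDomain hΩ δ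
  have hIm : MeasurableSet I := measurableSet_interactionDomain hΩ δ
  have hΩO : Ω ⊆ O := subset_union_left
  have hIsub : I ⊆ O := subset_union_right
  have hu2 : IsBM fun p : E d × E d => u₀ p.2 := hu.comp measurable_snd
  have hu1 : IsBM fun p : E d × E d => u₀ p.1 := hu.comp measurable_fst
  have hg2 : IsBM fun p : E d × E d => g p.2 := hg.comp measurable_snd
  have hA : IsBM fun p : E d × E d => Ω.indicator (fun y => u₀ y - u₀ p.1) p.2 :=
    (hu2.sub hu1).indicator (measurable_snd hΩ.measurableSet)
  have hB : IsBM fun p : E d × E d => I.indicator (fun y => g y - u₀ p.1) p.2 :=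
    (hg2.sub hu1).indicator (measurable_snd hIm)
  have hAi := (hk.integrable_mul_operator hO hw hA).mono_set hΩO
  have hBi := (hk.integrable_mul_operator hO hw hB).mono_set hΩO
  simp_rw [setIntegral_ball_inter_eq hOm hΩ.measurableSet hΩO,
    setIntegral_ball_inter_eq hOm hIm hIsub] at h
  -- For `x ∈ Ω` one has `g x = 0`, and `u₀ + g` is `u₀` on `Ω` and `g` on `I`. So the two inner
  -- integrals of the scheme are the two parts of one integral over `O`.
  have hsum : ∫ x in O, w x * ∫ y in O, ((u₀ y + g y) - (u₀ x + g x)) * k (y - x) =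
      (∫ x in Ω, w x * ∫ y in O, Ω.indicator (fun y => u₀ y - u₀ x) y * k (y - x)) +
      ∫ x in Ω, w x * ∫ y in O, I.indicator (fun y => g y - u₀ x) y * k (y - x) := by
    rw [← integral_add hAi hBi, setIntegral_eq_of_subset_of_forall_sdiff_eq_zero hOm hΩO
      fun x hx => by rw [hw0 x hx.2, zero_mul]]
    refine setIntegral_congr_fun hΩ.measurableSet fun x hx => ?_
    have hki : IntegrableOn (fun y => k (y - x)) O := (hk.integrable.comp_sub_right x).integrableOn
    have hslice : ∀ φ : E d → ℝ, IsBM φ → IntegrableOn (fun y => φ y * k (y - x)) O := by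
      rintro φ ⟨hm, C, hC⟩
      exact hki.bdd_mul hm.aestronglyMeasurable (ae_of_all _ hC)
    have hc : IsBM fun _ : E d => u₀ x := hu.comp measurable_const
    have hgx : g x = 0 := hg0 x fun hxI => hxI.1 hx
    simp only
    rw [← mul_add, ← integral_add (hslice _ ((hu.sub hc).indicator hΩ.measurableSet))
      (hslice _ ((hg.sub hc).indicator hIm))]
    congr 1
    refine setIntegral_congr_fun hOm fun y hy => ?_
    simp only [← add_mul, hgx]
    congr 1
    by_cases hyΩ : y ∈ Ω
    · have hyI : y ∉ I := fun hyI => hyI.1 hyΩ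
      simp [hyΩ, hyI, hg0 y hyI]
    · have hyI : y ∈ I := hy.resolve_left hyΩ
      simp [hyΩ, hyI, hu0 y hyΩ]
  rw [hk.energyForm_eq hO (hu.add hg) hw, hsum]
  linarith

end Variational

/-! ### Error estimate for a fixed horizon, and the resulting rates. -/

section ErrorEstimate

variable {d : ℕ}

lemma integral_operator_eq {O : Set (E d)} {δ G : ℝ} {k : E d → ℝ}
    (hk : IsRadialKernel d δ G k) {x : E d} (hx : Metric.ball x δ ⊆ O) (Φ : E d → ℝ) :
    ∫ y in O, (Φ y - Φ x) * k (y - x) = ∫ z, (Φ (x + z) - Φ x) * k z := by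
  rw [setIntegral_eq_integral_of_forall_compl_eq_zero fun y hy => by
      rw [hk.eq_zero (y - x) (not_lt.1 fun h => hy (hx (mem_ball_iff_norm.2 h))), mul_zero],
    ← integral_add_left_eq_self (fun y => (Φ y - Φ x) * k (y - x)) x]
  simp

lemma eLpNorm_two_restrict_eq {S : Set (E d)} (hS : MeasurableSet S) (hSv : volume S < ∞)
    {u e : E d → ℝ} (he : IsBM e) (hu : EqOn u e S) :
    eLpNorm u 2 (volume.restrict S) = ENNReal.ofReal (√(∫ x in S, e x ^ 2)) := by
  have : IsFiniteMeasure (volume.restrict S) := ⟨by simpa using hSv⟩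
  have hL : MemLp e 2 (volume.restrict S) := by
    obtain ⟨hm, C, hC⟩ := he
    exact MemLp.of_bound hm.aestronglyMeasurable C (ae_of_all _ hC)
  rw [eLpNorm_congr_ae ((ae_restrict_mem hS).mono fun x hx => hu hx),
    hL.eLpNorm_eq_integral_rpow_norm (by norm_num) (by norm_num), Real.sqrt_eq_rpow]
  simp

/-- Error estimate for a fixed horizon, in terms of the truncation error `T` and of the energy
bound `N` of the interpolation and data errors. -/
theorem cdg_error_le (hd : 1 ≤ d) {Ω : Set (E d)} (hΩ : IsOpenPolyhedron Ω) {δ : ℝ} (hδ : 0 < δ)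
    {γ : ℝ → ℝ} (hγ : IsKernelProfile d δ γ) {G : ℝ} (hG0 : 0 ≤ G)
    (hG : kernelMass Ω δ γ ≤ ENNReal.ofReal G) {D U : Set (E d)}
    (hID : interactionDomain Ω δ ⊆ D) (hU : IsOpen U) (hΩU : Ω ⊆ U) (hDU : D ⊆ U)
    {u : E d → ℝ} (hu : ContDiffOn ℝ 4 u U) {M₀ M₂ M₄ : ℝ} (hM₀ : ∀ x ∈ U, |u x| ≤ M₀)
    (hM₂ : ∀ x ∈ U, ‖iteratedFDeriv ℝ 2 u x‖ ≤ M₂) (hM₄ : ∀ x ∈ U, ‖iteratedFDeriv ℝ 4 u x‖ ≤ M₄)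
    {f g : E d → ℝ} (hf : ContinuousOn f Ω) {F : ℝ}
    (hfF : ∀ x ∈ Ω, |f x + Laplacian.laplacian u x| ≤ F) {ε₁ ε₂ : ℝ}
    (hg : ∀ x ∈ D, |g x - u x| ≤ ε₁) {h : ℝ} {K Kc : Geometry.SimplicialComplex ℝ (E d)}
    (hK : IsTriangulation K (closure Ω) h) (hKc : IsTriangulation Kc D h) {gh uh : E d → ℝ}
    (hgh : IsDataApprox Ω δ Kc g ε₂ gh) (huh : IsCDGSolution Ω δ γ K f gh uh)
    {A : ℝ} (hA0 : 0 ≤ A) (hA : volume (interactionDomain Ω δ) ≤ ENNReal.ofReal A)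
    {R c : ℝ} (hR0 : 0 ≤ R) (hR : ∀ x ∈ Ω, ∀ y ∈ Ω, ‖y - x‖ ≤ R) (hc : 0 < c)
    (hRc : (R + δ) ^ 2 ≤ 2 * d * c) {T N Q : ℝ} (hT : T = 2 * M₄ * d * δ ^ 2 + F)
    (hN : N = 8 * G * ((M₂ * h ^ 2) ^ 2 * volume.real Ω + (ε₁ + ε₂ + M₂ * h ^ 2) ^ 2 * A))
    (hQ : Q = 5 / 2 * N + 4 * c * T ^ 2 * volume.real Ω) :
    energyNorm Ω δ γ (fun x => u x - uh x) ≤ ENNReal.ofReal (√Q) ∧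
      eLpNorm (fun x => u x - uh x) 2 (volume.restrict Ω) ≤
        ENNReal.ofReal (√(c * (2 * Q + 2 * N))) := by
  have hΩo := hΩ.isOpen
  have hk := hγ.isRadialKernel hd hΩ.1 hG0 hG
  set k : E d → ℝ := cutKernel d δ γ
  set O := enlargedDomain Ω δ
  set I := interactionDomain Ω δ
  have hΩm : MeasurableSet Ω := hΩo.measurableSet
  have hOm : MeasurableSet O := measurableSet_enlargedDomain hΩo δ
  have hIm : MeasurableSet I := measurableSet_interactionDomain hΩo δ
  have hΩO : Ω ⊆ O := subset_union_left
  have hIsub : I ⊆ O := subset_union_right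
  have hball : ∀ x ∈ Ω, Metric.ball x δ ⊆ O := fun x hx => ball_subset_enlargedDomain hx
  have hOU : O ⊆ U := union_subset hΩU (hID.trans hDU)
  have hΩv : volume Ω < ∞ := hΩ.isBounded.measure_lt_top
  have hO : volume O < ∞ := (measure_union_le _ _).trans_lt
    (ENNReal.add_lt_top.2 ⟨hΩv, hA.trans_lt ENNReal.ofReal_lt_top⟩)
  -- The interpolation estimate needs whole closed simplices inside `U`. The boundary of `Ω` is
  -- covered because it lies in the interaction domain, hence in `D`.
  have hclU : closure Ω ⊆ U := by
    rw [closure_eq_self_union_frontier]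
    exact union_subset hΩU ((frontier_subset_interactionDomain hΩo hδ).trans (hID.trans hDU))
  have huc : ContinuousOn u U := hu.continuousOn
  have hu2 : ContDiffOn ℝ 2 u U := hu.of_le (by norm_num)
  obtain ⟨vg, hvg, hvgn, rfl⟩ := hgh
  obtain ⟨_, ⟨v₀, hv₀, rfl⟩, hgal, rfl⟩ := huh
  obtain ⟨vI, hvI, hvIn⟩ := exists_isPiecewiseLinear K u
  have hΩK : Ω ⊆ K.space := hK.space_eq ▸ subset_closure
  have hIK : I ⊆ Kc.space := hKc.space_eq ▸ hID
  have hu₀ : IsBM (Ω.indicator v₀) := hv₀.isBM_indicator hK.finite hΩm hΩK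
  have hgB : IsBM (I.indicator vg) := hvg.isBM_indicator hKc.finite hIm hIK
  have hΦ : IsBM (O.indicator u) := isBM_indicator hOm (huc.mono hOU) fun x hx => hM₀ x (hOU hx)
  -- the test function and the two parts of the remainder
  set w : E d → ℝ := Ω.indicator fun x => vI x - v₀ x with hw_def
  set ρ : E d → ℝ := Ω.indicator fun x => u x - vI x with hρ_def
  set e₂ : E d → ℝ := I.indicator fun x => u x - vg x with he₂_def
  have hwV : w ∈ interiorSpace Ω K := ⟨_, hvI.sub hv₀, rfl⟩
  have hw : IsBM w := (hvI.sub hv₀).isBM_indicator hK.finite hΩm hΩK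
  have hw0 : ∀ x ∉ Ω, w x = 0 := fun x hx => indicator_of_notMem hx _
  have hρle : ∀ x ∈ Ω, |u x - vI x| ≤ M₂ * h ^ 2 := fun x hx => by
    have := hvI.abs_sub_le hK hU hclU hu2 hM₂ (ε := 0) (fun p hp => by simp [hvIn p hp])
      (subset_closure hx)
    rwa [abs_sub_comm, zero_add] at this
  have he₂le : ∀ x ∈ I, |u x - vg x| ≤ ε₁ + ε₂ + M₂ * h ^ 2 := fun x hx => by
    have := hvg.abs_sub_le hKc hU hDU hu2 hM₂ (ε := ε₁ + ε₂) (fun p hp => by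
      have hpD : p ∈ D := by
        rw [← hKc.space_eq]
        exact Kc.subset_space (s := {p}) hp (by simp)
      have h1 := abs_sub_le (vg p) (g p) (u p)
      linarith [hg p hpD, hvgn p hp]) (hID hx)
    rwa [abs_sub_comm] at this
  have hρ : IsBM ρ := isBM_indicator hΩm ((huc.mono hΩU).sub
    ((hvI.continuousOn hK.finite).mono hΩK)) hρle
  have he₂ : IsBM e₂ := isBM_indicator hIm ((huc.mono (hID.trans hDU)).sub
    ((hvg.continuousOn hKc.finite).mono hIK)) he₂le
  set uf : E d → ℝ := fun x => Ω.indicator v₀ x + I.indicator vg x with huf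
  have hufB : IsBM uf := hu₀.add hgB
  set e : E d → ℝ := fun x => O.indicator u x - uf x with he_def
  have he : IsBM e := hΦ.sub hufB
  have hsplit : ∀ x, e x = w x + (ρ x + e₂ x) := by
    intro x
    by_cases hxΩ : x ∈ Ω
    · have hxI : x ∉ I := fun hxI => hxI.1 hxΩ
      simp only [he_def, huf, hw_def, hρ_def, he₂_def, indicator_of_mem hxΩ,
        indicator_of_mem (hΩO hxΩ), indicator_of_notMem hxI]
      ring
    · by_cases hxI : x ∈ I
      · simp [he_def, huf, hw_def, hρ_def, he₂_def, hxΩ, hxI, hIsub hxI]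
      · have hxO : x ∉ O := fun hxO => hxO.elim hxΩ hxI
        simp [he_def, huf, hw_def, hρ_def, he₂_def, hxΩ, hxI, hxO]
  -- energies of the remainder
  have hen₂ : energy O k e₂ ≤ 4 * G * ((ε₁ + ε₂ + M₂ * h ^ 2) ^ 2 * A) := by
    refine (hk.energy_le_four_mul hO he₂).trans (mul_le_mul_of_nonneg_left ?_ (by positivity))
    exact setIntegral_sq_le hIm hIsub hA0 hA
      (fun x hx => by rw [he₂_def, indicator_of_mem hx]; exact he₂le x hx)
      fun x hx => indicator_of_notMem hx _
  have henρ : energy O k ρ ≤ 4 * G * ((M₂ * h ^ 2) ^ 2 * volume.real Ω) := by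
    refine (hk.energy_le_four_mul hO hρ).trans (mul_le_mul_of_nonneg_left ?_ (by positivity))
    exact setIntegral_sq_le hΩm hΩO measureReal_nonneg
      (by rw [Measure.real, ENNReal.ofReal_toReal hΩv.ne])
      (fun x hx => by rw [hρ_def, indicator_of_mem hx]; exact hρle x hx)
      fun x hx => indicator_of_notMem hx _
  have henη : energy O k (fun x => ρ x + e₂ x) ≤ N := by
    have := hk.energy_add_le hO hρ he₂
    rw [hN]
    linarith
  -- Used only for the `L²` bound, where `e₂` is subtracted from the error.
  have hen₂N : energy O k e₂ ≤ N := by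
    have h1 : 0 ≤ 4 * G * ((ε₁ + ε₂ + M₂ * h ^ 2) ^ 2 * A) := by positivity
    have h2 : 0 ≤ 8 * G * ((M₂ * h ^ 2) ^ 2 * volume.real Ω) := by positivity
    rw [hN]
    linarith
  have hP : ∀ φ, IsBM φ → (∀ x ∉ Ω, φ x = 0) →
      ∫ x in Ω, φ x ^ 2 ≤ c * energy O k φ := by
    intro φ hφ hφ0
    have h1 := hk.poincare hO hΩm hΩO hball hφ hφ0 hR0 hR
    have h2 : (R + δ) ^ 2 * energy O k φ ≤ 2 * d * c * energy O k φ :=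
      mul_le_mul_of_nonneg_right hRc (hk.energy_nonneg φ)
    have hd' : (0 : ℝ) < 2 * d := by
      have : (0 : ℝ) < d := by exact_mod_cast hd
      positivity
    exact le_of_mul_le_mul_left (by linarith) hd'
  -- consistency
  have hTle : ∀ x ∈ Ω, |2 * (∫ y in O, (O.indicator u y - O.indicator u x) * k (y - x)) + f x|
      ≤ T := by
    intro x hx
    have h1 := hk.abs_two_mul_integral_sub_laplacian_le hU hu hM₄ hΦ (hΩU hx)
      ((hball x hx).trans hOU) fun y hy => indicator_of_mem (hball x hx hy) u
    rw [integral_operator_eq hk (hball x hx), hT]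
    have h2 := hfF x hx
    rw [abs_le] at h1 h2 ⊢
    constructor <;> linarith
  have hgal' := energyForm_galerkin hΩo hk hO hu₀ (fun x hx => indicator_of_notMem hx _) hgB
    (fun x hx => indicator_of_notMem hx _) hw hw0 (hgal w hwV)
  have hB : energyForm O k e w ≤ T * ∫ x in Ω, |w x| :=
    hk.energyForm_error_le hOm hO hΩm hΩO hΦ hufB hw hw0 (hf.aestronglyMeasurable hΩm) hTle hgal'
  have hene : energy O k e ≤ Q := by
    have := hk.energy_error_le hO hΩO he hw (hρ.add he₂) hsplit hc (hP w hw hw0) hB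
    rw [hQ]
    linarith
  have heO : EqOn (fun x => u x - uf x) e O := fun x hx => by
    simp only [he_def, indicator_of_mem hx]
  refine ⟨?_, ?_⟩
  · rw [energyNorm_eq hΩo hδ hk hγ.eq_zero hO he heO]
    exact ENNReal.ofReal_le_ofReal (Real.sqrt_le_sqrt hene)
  · rw [eLpNorm_two_restrict_eq hΩm hΩv he (heO.mono hΩO)]
    refine ENNReal.ofReal_le_ofReal (Real.sqrt_le_sqrt ?_)
    -- Poincaré does not apply to `e`, which need not vanish on the collar. Subtracting `e₂` leaves
    -- the values on `Ω` unchanged and gives `w + ρ`, which vanishes outside `Ω`.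
    have h1 : ∫ x in Ω, e x ^ 2 = ∫ x in Ω, (e x - e₂ x) ^ 2 := by
      refine setIntegral_congr_fun hΩm fun x hx => ?_
      have hxI : x ∉ I := fun hxI => hxI.1 hx
      simp [he₂_def, hxI]
    rw [h1]
    refine (hP _ (he.sub he₂) fun x hx => ?_).trans (mul_le_mul_of_nonneg_left ?_ hc.le)
    · rw [hsplit x, hw0 x hx, hρ_def, indicator_of_notMem hx]
      ring
    · linarith [hk.energy_sub_le hO he he₂]

/-- The rates of the truncation, interpolation and data errors. -/
lemma rate_le {δ δ₀ h μ' MG M₂ v V Mg κ : ℝ} (hδ : 0 < δ) (hδ₀ : δ ≤ δ₀) (hMG : 0 ≤ MG)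
    (hv : 0 ≤ v) (hV : 0 ≤ V) {μ : ℕ} (hμ : μ = 0 ∨ μ = 1)
    (hμ' : μ' = Mg * δ ^ (2 + μ) + κ * h ^ 2) :
    8 * (MG / δ ^ 2) * ((M₂ * h ^ 2) ^ 2 * v + μ' ^ 2 * (V * δ)) ≤
      (8 * MG * M₂ ^ 2 * v + 16 * MG * V * (Mg ^ 2 * (1 + δ₀) + κ ^ 2 * δ₀)) *
        (δ ^ (3 + μ) + (δ⁻¹ * h ^ 2) ^ 2) ∧
      (δ ^ 2) ^ 2 ≤ (1 + δ₀) * (δ ^ (3 + μ) + (δ⁻¹ * h ^ 2) ^ 2) := by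
  set Y := (δ⁻¹ * h ^ 2) ^ 2 with hY
  set X := δ ^ (3 + μ) with hX
  have hX0 : 0 ≤ X := by positivity
  have hY0 : 0 ≤ Y := sq_nonneg _
  have hδ₀' : 0 ≤ δ₀ := hδ.le.trans hδ₀
  have hδY : h ^ 4 = δ ^ 2 * Y := by
    rw [hY]
    field_simp
  -- The data error has squared rate `3 + 2μ` and the truncation error has squared rate `4`. For `μ
  -- = 0` the data error dictates `3 + μ`, for `μ = 1` the truncation error does; surplus powers of
  -- `δ` are bounded through `δ₀`.
  have h3 : δ ^ (3 + 2 * μ) ≤ (1 + δ₀) * X := by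
    rcases hμ with rfl | rfl
    · simp only [hX, mul_zero, add_zero]
      nlinarith [pow_pos hδ 3]
    · calc δ ^ (3 + 2 * 1) = δ * X := by rw [hX]; ring
        _ ≤ (1 + δ₀) * X := by gcongr; linarith
  have h4 : (δ ^ 2) ^ 2 ≤ (1 + δ₀) * X := by
    rcases hμ with rfl | rfl
    · simp only [hX, add_zero]
      nlinarith [pow_pos hδ 3]
    · calc (δ ^ 2) ^ 2 = 1 * X := by rw [hX]; ring
        _ ≤ (1 + δ₀) * X := by gcongr; linarith
  constructor
  · have h5 : μ' ^ 2 ≤ 2 * (Mg ^ 2 * (δ * δ ^ (3 + 2 * μ)) + κ ^ 2 * (δ ^ 2 * Y)) := by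
      have : δ * δ ^ (3 + 2 * μ) = (δ ^ (2 + μ)) ^ 2 := by ring
      rw [this, ← hδY, hμ']
      nlinarith [sq_nonneg (Mg * δ ^ (2 + μ) - κ * h ^ 2)]
    have h6 : μ' ^ 2 ≤ 2 * δ * (Mg ^ 2 * ((1 + δ₀) * X) + κ ^ 2 * (δ₀ * Y)) := by
      refine h5.trans ?_
      have : δ ^ 2 * Y ≤ δ * (δ₀ * Y) := by
        rw [sq, mul_assoc]
        gcongr
      calc 2 * (Mg ^ 2 * (δ * δ ^ (3 + 2 * μ)) + κ ^ 2 * (δ ^ 2 * Y))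
          ≤ 2 * (Mg ^ 2 * (δ * ((1 + δ₀) * X)) + κ ^ 2 * (δ * (δ₀ * Y))) := by gcongr
        _ = _ := by ring
    calc 8 * (MG / δ ^ 2) * ((M₂ * h ^ 2) ^ 2 * v + μ' ^ 2 * (V * δ))
        ≤ 8 * (MG / δ ^ 2) * (M₂ ^ 2 * (δ ^ 2 * Y) * v +
            2 * δ * (Mg ^ 2 * ((1 + δ₀) * X) + κ ^ 2 * (δ₀ * Y)) * (V * δ)) := by
          have : (M₂ * h ^ 2) ^ 2 = M₂ ^ 2 * (δ ^ 2 * Y) := by rw [← hδY]; ring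
          rw [this]
          gcongr
      _ = 8 * MG * M₂ ^ 2 * v * Y +
            16 * MG * V * (Mg ^ 2 * (1 + δ₀) * X + κ ^ 2 * δ₀ * Y) := by
          field_simp
          ring
      _ ≤ 8 * MG * M₂ ^ 2 * v * (X + Y) +
            16 * MG * V * (Mg ^ 2 * (1 + δ₀) * (X + Y) + κ ^ 2 * δ₀ * (X + Y)) := by
          gcongr <;> linarith
      _ = _ := by ring
  · exact h4.trans (by gcongr; linarith)

lemma sqrt_mul_rate_le {C δ m n : ℝ} {μ : ℕ} (hδ : 0 < δ) (hn : 0 ≤ n)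
    (hm : m = δ ^ ((3 + (μ : ℝ)) / 2)) :
    √(C * (δ ^ (3 + μ) + n ^ 2)) ≤ √C * (m + n) := by
  have hm0 : 0 ≤ m := hm ▸ (Real.rpow_nonneg hδ.le _)
  have hm2 : δ ^ (3 + μ) = m ^ 2 := by
    rw [hm, ← Real.rpow_natCast, ← Real.rpow_mul_natCast hδ.le]
    congr 1
    push_cast
    ring
  rw [Real.sqrt_mul' _ (by positivity), hm2]
  gcongr
  refine Real.sqrt_le_iff.2 ⟨by positivity, ?_⟩
  nlinarith [mul_nonneg hm0 hn]

end ErrorEstimate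

end NonlocalCDG

/-! ### The theorem: collecting constants uniform in `δ`, `h` and the triangulations. -/

theorem mainTheorem1 {d : ℕ} (hd : 1 ≤ d)
    -- the polyhedron, and the local problem with its solution
    (Ω : Set (NonlocalCDG.E d)) (hΩ : NonlocalCDG.IsOpenPolyhedron Ω)
    (f₀ g₀ u₀ : NonlocalCDG.E d → ℝ)
    (hu₀ : NonlocalCDG.IsLocalSolution Ω f₀ g₀ u₀) (hu₀_C4 : NonlocalCDG.IsCb 4 Ω u₀)
    -- the family of kernels, for horizons `0 < δ ≤ δ₀`
    (δ₀ : ℝ) (hδ₀ : 0 < δ₀)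
    (γ : ℝ → ℝ → ℝ)
    (hγ : ∀ δ, 0 < δ → δ ≤ δ₀ → NonlocalCDG.IsKernelProfile d δ (γ δ))
    (hG : ∃ M : ℝ, ∀ δ, 0 < δ → δ ≤ δ₀ →
      NonlocalCDG.kernelMass Ω δ (γ δ) ≤ ENNReal.ofReal (M / δ ^ 2))
    -- the polyhedral regions `D δ ⊇ Ω_δ^c` outside `Ω` on which the constraint is discretized
    (D : ℝ → Set (NonlocalCDG.E d))
    (hD : ∀ δ, 0 < δ → δ ≤ δ₀ →
      NonlocalCDG.interactionDomain Ω δ ⊆ D δ ∧ Disjoint (D δ) Ω)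
    -- the `C^4` extension of `u₀`
    (U : Set (NonlocalCDG.E d)) (hU : IsOpen U)
    (hΩU : Ω ⊆ U) (hDU : ∀ δ, 0 < δ → δ ≤ δ₀ → D δ ⊆ U)
    (ũ₀ : NonlocalCDG.E d → ℝ) (hũ₀ : NonlocalCDG.IsCb 4 U ũ₀) (hext : Set.EqOn ũ₀ u₀ Ω)
    -- the perturbed data
    (μ : ℕ) (hμ : μ = 0 ∨ μ = 1)
    (f g : ℝ → NonlocalCDG.E d → ℝ)
    (hf_cont : ∀ δ, 0 < δ → δ ≤ δ₀ → ContinuousOn (f δ) Ω)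
    (hg_cont : ∀ δ, 0 < δ → δ ≤ δ₀ → ContinuousOn (g δ) (D δ))
    (hf : ∃ M : ℝ, ∀ δ, 0 < δ → δ ≤ δ₀ → ∀ x ∈ Ω, |f δ x - f₀ x| ≤ M * δ ^ 2)
    (hg : ∃ M : ℝ, ∀ δ, 0 < δ → δ ≤ δ₀ → ∀ x ∈ D δ, |g δ x - ũ₀ x| ≤ M * δ ^ (2 + μ))
    -- the accuracy constant of the nodal approximation of `g δ`
    (κ : ℝ) :
    ∃ C : ℝ, 0 < C ∧
      ∀ δ, 0 < δ → δ ≤ δ₀ → ∀ h, 0 < h →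
      ∀ K Kc : Geometry.SimplicialComplex ℝ (NonlocalCDG.E d),
        NonlocalCDG.IsTriangulation K (closure Ω) h →
        NonlocalCDG.IsTriangulation Kc (D δ) h →
      ∀ gh uh : NonlocalCDG.E d → ℝ,
        NonlocalCDG.IsDataApprox Ω δ Kc (g δ) (κ * h ^ 2) gh →
        NonlocalCDG.IsCDGSolution Ω δ (γ δ) K (f δ) gh uh →
        NonlocalCDG.energyNorm Ω δ (γ δ) (fun x => ũ₀ x - uh x) ≤
            ENNReal.ofReal (C * (δ ^ ((3 + (μ : ℝ)) / 2) + δ⁻¹ * h ^ 2)) ∧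
          MeasureTheory.eLpNorm (fun x => u₀ x - uh x) 2 (MeasureTheory.volume.restrict Ω) ≤
            ENNReal.ofReal (C * (δ ^ ((3 + (μ : ℝ)) / 2) + δ⁻¹ * h ^ 2)) := by
  obtain ⟨hu, hub⟩ := hũ₀
  obtain ⟨M₀, hM₀⟩ := hub 0 (by norm_num)
  obtain ⟨M₂, hM₂⟩ := hub 2 (by norm_num)
  obtain ⟨M₄, hM₄⟩ := hub 4 le_rfl
  obtain ⟨MG, hMG⟩ := hG
  obtain ⟨Mf, hMf⟩ := hf
  obtain ⟨Mg, hMg⟩ := hg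
  obtain ⟨V, hV0, hV⟩ := hΩ.volume_interactionDomain_le hd δ₀
  obtain ⟨R, hR0, hR⟩ : ∃ R : ℝ, 0 ≤ R ∧ ∀ x ∈ Ω, ∀ y ∈ Ω, ‖y - x‖ ≤ R := by
    obtain ⟨R, hR⟩ := Metric.isBounded_iff.1 hΩ.isBounded
    refine ⟨max R 0, le_max_right _ _, fun x hx y hy => le_max_of_le_left ?_⟩
    rw [← dist_eq_norm]
    exact hR hy hx
  have hd' : (0 : ℝ) < d := by exact_mod_cast hd
  -- The Poincaré constant at the largest horizon, valid for all `δ ≤ δ₀`.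
  set c : ℝ := (R + δ₀) ^ 2 / (2 * d) with hc_def
  have hc : 0 < c := by positivity
  set v := MeasureTheory.volume.real Ω
  have hv : 0 ≤ v := MeasureTheory.measureReal_nonneg
  set CN : ℝ := 8 * |MG| * M₂ ^ 2 * v +
    16 * |MG| * V * (Mg ^ 2 * (1 + δ₀) + (κ + M₂) ^ 2 * δ₀)
  set CQ : ℝ := 5 / 2 * CN + 4 * c * ((2 * M₄ * d + Mf) ^ 2 * (1 + δ₀)) * v
  set CL : ℝ := c * (2 * CQ + 2 * CN)
  -- `CQ` serves the energy norm and `CL` the `L²` norm; the added 1 only ensures positivity.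
  refine ⟨√CQ + √CL + 1, by positivity, fun δ hδ hδδ₀ h hh K Kc hK hKc gh uh hgh huh => ?_⟩
  set Z := δ ^ (3 + μ) + (δ⁻¹ * h ^ 2) ^ 2
  set m := δ ^ ((3 + (μ : ℝ)) / 2) with hm
  have hlap : ∀ x ∈ Ω, |f δ x + Laplacian.laplacian ũ₀ x| ≤ Mf * δ ^ 2 := by
    intro x hx
    have h1 : Laplacian.laplacian ũ₀ x = Laplacian.laplacian u₀ x :=
      (InnerProductSpace.laplacian_congr_nhds
        (hext.eventuallyEq_of_mem (hΩ.isOpen.mem_nhds hx))).eq_of_nhds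
    have h2 := hMf δ hδ hδδ₀ x hx
    rwa [← hu₀.pde x hx, sub_neg_eq_add, ← h1] at h2
  have hmass : NonlocalCDG.kernelMass Ω δ (γ δ) ≤ ENNReal.ofReal (|MG| / δ ^ 2) :=
    (hMG δ hδ hδδ₀).trans (ENNReal.ofReal_le_ofReal (by gcongr; exact le_abs_self MG))
  have hRc : (R + δ) ^ 2 ≤ 2 * d * c := by
    rw [hc_def, mul_div_cancel₀ _ (by positivity)]
    gcongr
  obtain ⟨hE, hL⟩ := NonlocalCDG.cdg_error_le hd hΩ hδ (hγ δ hδ hδδ₀)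
    (by positivity) hmass (hD δ hδ hδδ₀).1 hU hΩU (hDU δ hδ hδδ₀) hu
    (fun x hx => by simpa using hM₀ x hx) hM₂ hM₄ (hf_cont δ hδ hδδ₀) hlap
    (hMg δ hδ hδδ₀) hK hKc hgh huh (by positivity) (hV δ hδ hδδ₀) hR0 hR hc hRc rfl rfl rfl
  -- The exterior interpolation error `M₂ * h ^ 2` has the same form as the nodal error `κ * h ^ 2`,
  -- so both are treated together with constant `κ + M₂`.
  obtain ⟨hN, hδ4⟩ := NonlocalCDG.rate_le (h := h) (M₂ := M₂) (v := v) (V := V) (Mg := Mg)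
    (κ := κ + M₂) hδ hδδ₀ (abs_nonneg MG) hv hV0 hμ rfl
  rw [show Mg * δ ^ (2 + μ) + (κ + M₂) * h ^ 2 =
    Mg * δ ^ (2 + μ) + κ * h ^ 2 + M₂ * h ^ 2 by ring] at hN
  set N := 8 * (|MG| / δ ^ 2) * ((M₂ * h ^ 2) ^ 2 * v +
    (Mg * δ ^ (2 + μ) + κ * h ^ 2 + M₂ * h ^ 2) ^ 2 * (V * δ))
  have hQ : 5 / 2 * N + 4 * c * (2 * M₄ * d * δ ^ 2 + Mf * δ ^ 2) ^ 2 * v ≤ CQ * Z := by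
    calc 5 / 2 * N + 4 * c * (2 * M₄ * d * δ ^ 2 + Mf * δ ^ 2) ^ 2 * v
        = 5 / 2 * N + 4 * c * ((2 * M₄ * d + Mf) ^ 2 * (δ ^ 2) ^ 2) * v := by ring
      _ ≤ 5 / 2 * (CN * Z) + 4 * c * ((2 * M₄ * d + Mf) ^ 2 * ((1 + δ₀) * Z)) * v := by gcongr
      _ = CQ * Z := by ring
  have hrate : 0 ≤ m + δ⁻¹ * h ^ 2 := by positivity
  have hQs := (Real.sqrt_le_sqrt hQ).trans
    (NonlocalCDG.sqrt_mul_rate_le (n := δ⁻¹ * h ^ 2) hδ (by positivity) hm)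
  have hLs := (Real.sqrt_le_sqrt (show c * (2 * (5 / 2 * N +
      4 * c * (2 * M₄ * d * δ ^ 2 + Mf * δ ^ 2) ^ 2 * v) + 2 * N) ≤ CL * Z by
    calc _ ≤ c * (2 * (CQ * Z) + 2 * (CN * Z)) := by gcongr
      _ = CL * Z := by ring)).trans
    (NonlocalCDG.sqrt_mul_rate_le (n := δ⁻¹ * h ^ 2) hδ (by positivity) hm)
  refine ⟨hE.trans (ENNReal.ofReal_le_ofReal (hQs.trans ?_)), ?_⟩
  · gcongr
    linarith [Real.sqrt_nonneg CL]
  · have hcongr : MeasureTheory.eLpNorm (fun x => u₀ x - uh x) 2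
          (MeasureTheory.volume.restrict Ω) =
        MeasureTheory.eLpNorm (fun x => ũ₀ x - uh x) 2 (MeasureTheory.volume.restrict Ω) :=
      MeasureTheory.eLpNorm_congr_ae
        ((MeasureTheory.ae_restrict_mem hΩ.isOpen.measurableSet).mono fun x hx => by
          simp only [hext hx])
    rw [hcongr]
    refine hL.trans (ENNReal.ofReal_le_ofReal (hLs.trans ?_))
    gcongr
    linarith [Real.sqrt_nonneg CQ]
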